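/- **Setting.** Let $F,G\in\mathbb{R}[x_0,x_1,x_2,x_3]$ be forms of the same degree $d$, irreducible over $\mathbb{C}$, and let $R,S\subset\mathbb{E}^3_{\mathbb R}$ be the real surfaces $F(1,x_1,x_2,x_3)=0$ and $G(1,x_1,x_2,x_3)=0$. Assume that $\dim_{\mathbb R}R=\dim_{\mathbb R}S=2$ and that neither $R$ nor $S$ is a cylinder (invariant under all translations in some direction), a cone (invariant under all scalings with some centre) or a surface of revolution (invariant under all rotations about some axis). Let $\mathrm{Sim}_{R,S}$ be the set of direct similarities $\psi(x)=Ax+b$ (with $A^{\top}A=cI$, $c>0$, $\det A>0$) such that $\psi(R)=S$. Such a $\psi$ acts on the complexified plane at infinity $x_0=0$ by $[x_1:x_2:x_3]\mapsto A[x_1:x_2:x_3]$, and preserves the absolute conic $\Omega: x_1^2+x_2^2+x_3^2=0$ in it. Let $\mu:\mathbb{P}^1_{\mathbb C}\to\Omega$ be an isomorphism given by binary quadratic forms, for example $[s:t]\mapsto[2st:s^2-t^2:\mathrm{i}(s^2+t^2)]$. Write $$F(0,x_1,x_2,x_3)=(x_1^2+x_2^2+x_3^2)^{k}\,\widetilde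 F,\qquad G(0,x_1,x_2,x_3)=(x_1^2+x_2^2+x_3^2)^{l}\,\widetilde G,$$ where $x_1^2+x_2^2+x_3^2$ divides neither $\widetilde F$ nor $\widetilde G$. For binary forms $P,Q$ over $\mathbb C$ put $$\mathrm{Aut}(\mathbb{P}^1)_{P,Q}=\{\varphi\in \mathrm{Aut}(\mathbb{P}^1_{\mathbb C})=PGL_2(\mathbb C)\mid \exists \lambda\in\mathbb{C}^*:\ Q\circ\varphi=\lambda P\}.$$ **Theorem.** Suppose that $\widetilde F$ and $\widetilde G$ are not constant, and let $P=\mu^*\widetilde F$, $Q=\mu^*\widetilde G$. Then $\mathrm{Aut}(\mathbb{P}^1)_{P,Q}$ is a good candidate set for $\mathrm{Sim}_{R,S}$, in the following sense. 1. Restriction to $\Omega$, $\iota(\psi)=\mu^{-1}\circ\psi|_{\Omega}\circ\mu$, defines an injective map $\iota:\mathrm{Sim}_{R,S}\hookrightarrow\mathrm{Aut}(\mathbb{P}^1)_{P,Q}$. 2. The zero sets of $P$ and of $Q$ in $\mathbb{P}^1_{\mathbb C}$ are finite and have at least two points each, and every $\varphi\in\mathrm{Aut}(\mathbb{P}^1)_{P,Q}$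 maps the zero set of $P$ onto the zero set of $Q$. 3. If $P$ has at least three distinct zeros, then $\mathrm{Sim}_{R,S}$ and $\mathrm{Aut}(\mathbb{P}^1)_{P,Q}$ are both finite (so they have the same dimension, $0$). -/

import Mathlib

open MvPolynomial
open scoped LinearAlgebra.Projectivization MatrixGroups

noncomputable section

namespace SurfaceSim

/-- Real affine 3-space, the affine part `x₀ ≠ 0` of the real projective 3-space.
Euclidean notions enter only through the matrix condition in `similitude`. -/
abbrev E3 : Type := Fin 3 → ℝ

/-- The complex projective line. -/
abbrev P1 : Type := ℙ ℂ (Fin 2 → ℂ)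

/-- The complexified plane at infinity `x₀ = 0` of projective 3-space,
with homogeneous coordinates `[x₁ : x₂ : x₃]`. -/
abbrev PInf : Type := ℙ ℂ (Fin 3 → ℂ)

/-! ### Direct similarities -/

/-- The matrices `A` with `AᵀA = c I` for some `c > 0` and `det A > 0`. -/
def similitude : Subgroup (GL (Fin 3) ℝ) where
  carrier := {A | (∃ c : ℝ, 0 < c ∧
      (A : Matrix (Fin 3) (Fin 3) ℝ).transpose * (A : Matrix (Fin 3) (Fin 3) ℝ) = c • 1) ∧
      0 < (A : Matrix (Fin 3) (Fin 3) ℝ).det}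
  mul_mem' := by
    rintro A B ⟨⟨a, ha, hA⟩, hdA⟩ ⟨⟨b, hb, hB⟩, hdB⟩
    refine ⟨⟨a * b, mul_pos ha hb, ?_⟩, ?_⟩
    · rw [Units.val_mul, Matrix.transpose_mul, Matrix.mul_assoc,
        ← Matrix.mul_assoc _ (A : Matrix (Fin 3) (Fin 3) ℝ), hA]
      simp [hB, mul_smul]
    · rw [Units.val_mul, Matrix.det_mul]
      exact mul_pos hdA hdB
  one_mem' := ⟨⟨1, one_pos, by simp⟩, by simp⟩
  inv_mem' := by
    rintro A ⟨⟨a, ha, hA⟩, hdA⟩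
    have hAi : (A : Matrix (Fin 3) (Fin 3) ℝ) * ((A⁻¹ : GL (Fin 3) ℝ) : Matrix _ _ ℝ) = 1 := by
      rw [← Units.val_mul]; simp
    refine ⟨⟨a⁻¹, inv_pos.2 ha, ?_⟩, ?_⟩
    · have h1 : (((A⁻¹ : GL (Fin 3) ℝ) : Matrix _ _ ℝ)).transpose *
          ((A : Matrix (Fin 3) (Fin 3) ℝ).transpose * (A : Matrix (Fin 3) (Fin 3) ℝ)) *
          ((A⁻¹ : GL (Fin 3) ℝ) : Matrix _ _ ℝ) = 1 := by
        rw [← Matrix.mul_assoc, ← Matrix.transpose_mul, hAi, Matrix.transpose_one,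
          Matrix.one_mul, hAi]
      rw [hA] at h1
      simp only [Matrix.mul_smul, Matrix.mul_one, Matrix.smul_mul] at h1
      rw [← h1, smul_smul, inv_mul_cancel₀ ha.ne', one_smul]
    · have h2 := congrArg Matrix.det hAi
      rw [Matrix.det_mul, Matrix.det_one] at h2
      exact (mul_pos_iff_of_pos_left hdA).1 (by rw [h2]; exact one_pos)

/-- The matrix of the linear part of an affine transformation of 3-space. -/
def linMatrix : (E3 ≃ᵃ[ℝ] E3) →* GL (Fin 3) ℝ :=
  (Matrix.GeneralLinearGroup.toLin (n := Fin 3) (R := ℝ)).symm.toMonoidHom.comp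
    ((LinearMap.GeneralLinearGroup.generalLinearEquiv ℝ E3).symm.toMonoidHom.comp
      AffineEquiv.linearHom)

/-- The group of direct similarities of Euclidean 3-space. -/
def Sim : Subgroup (E3 ≃ᵃ[ℝ] E3) := similitude.comap linMatrix

/-- The set `Sim_{A,B}` of direct similarities `φ` with `φ(A) = B`. -/
def simSet (A B : Set E3) : Set (E3 ≃ᵃ[ℝ] E3) := {φ | φ ∈ Sim ∧ φ '' A = B}

/-- The action of an affine transformation `x ↦ A x + b` on the complexified plane at
infinity: `[0 : x] ↦ [0 : A x]`. -/
def actInf (φ : E3 ≃ᵃ[ℝ] E3) (p : PInf) : PInf :=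
  Matrix.GeneralLinearGroup.map (algebraMap ℝ ℂ) (linMatrix φ) • p

/-! ### Real algebraic surfaces -/

/-- The real zero set in affine 3-space of a form `F(x₀, x₁, x₂, x₃)`. -/
def realLocus (F : MvPolynomial (Fin 4) ℝ) : Set E3 :=
  {x | eval (Fin.cons 1 x : Fin 4 → ℝ) F = 0}

/-- The dimension of a subset `A` of real affine 3-space in the sense of real algebraic
geometry: the Krull dimension of `ℝ[x₁, x₂, x₃] / I(A)`. -/
def realDim (A : Set E3) : WithBot ℕ∞ :=
  ringKrullDim (MvPolynomial (Fin 3) ℝ ⧸ (vanishingIdeal ℝ A : Ideal (MvPolynomial (Fin 3) ℝ)))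

/-- `F` is a form of degree `d`, irreducible over `ℂ`, whose real zero set is
two-dimensional. -/
structure IsSurfaceForm (d : ℕ) (F : MvPolynomial (Fin 4) ℝ) : Prop where
  isHomogeneous : F.IsHomogeneous d
  irreducible : Irreducible (map (algebraMap ℝ ℂ) F)
  dim : realDim (realLocus F) = 2

/-- Invariant under all translations in some direction. -/
def IsCylinder (A : Set E3) : Prop :=
  ∃ v : E3, v ≠ 0 ∧ ∀ t : ℝ, (fun x => x + t • v) '' A = A

/-- Invariant under all scalings (homotheties) with some centre. -/
def IsCone (A : Set E3) : Prop :=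
  ∃ c : E3, ∀ t : ℝ, t ≠ 0 → (fun x => c + t • (x - c)) '' A = A

/-- Invariant under all rotations about some axis. The rotations about the axis through `p`
with direction `u` are exactly the direct similarities fixing `p` and `p + u`. -/
def IsRevolution (A : Set E3) : Prop :=
  ∃ p u : E3, u ≠ 0 ∧ ∀ φ ∈ Sim, φ p = p → φ (p + u) = p + u → φ '' A = A

/-! ### The section at infinity -/

/-- `F(0, x₁, x₂, x₃)`. -/
def atInfinity (F : MvPolynomial (Fin 4) ℝ) : MvPolynomial (Fin 3) ℝ :=
  aeval (Fin.cons 0 X : Fin 4 → MvPolynomial (Fin 3) ℝ) F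

/-- `x₁² + x₂² + x₃²`. -/
def absForm : MvPolynomial (Fin 3) ℝ := ∑ i, X i ^ 2

/-- `F(0, x₁, x₂, x₃) = (x₁² + x₂² + x₃²)ᵏ F̃(x₁, x₂, x₃)` for some `k`, where
`x₁² + x₂² + x₃²` does not divide `F̃`. -/
def IsReducedInfinityPart (F : MvPolynomial (Fin 4) ℝ) (Ft : MvPolynomial (Fin 3) ℝ) : Prop :=
  (∃ k : ℕ, atInfinity F = absForm ^ k * Ft) ∧ ¬ absForm ∣ Ft

/-- The absolute conic `x₁² + x₂² + x₃² = 0` in the plane at infinity. -/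
def absConic : Set PInf := {p | Projectivization.orthogonal p p}

/-- `μ` is an isomorphism from the projective line onto the absolute conic, given by the
triple `m` of binary quadratic forms. -/
structure IsConicParam (μ : P1 → PInf) (m : Fin 3 → MvPolynomial (Fin 2) ℂ) : Prop where
  isHomogeneous : ∀ i, (m i).IsHomogeneous 2
  map_mk : ∀ (v : Fin 2 → ℂ) (hv : v ≠ 0), ∃ hw : (fun i => eval v (m i)) ≠ 0,
    μ (Projectivization.mk ℂ v hv) = Projectivization.mk ℂ (fun i => eval v (m i)) hw
  bijOn : Set.BijOn μ Set.univ absConic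

/-- The pull-back of a ternary form under the parametrization with component forms `m`. -/
def pullback (m : Fin 3 → MvPolynomial (Fin 2) ℂ) (H : MvPolynomial (Fin 3) ℝ) :
    MvPolynomial (Fin 2) ℂ := bind₁ m (map (algebraMap ℝ ℂ) H)

/-! ### Binary forms and automorphisms of the projective line -/

/-- The composition `P ∘ B` of a binary form with a linear substitution. -/
def comp (P : MvPolynomial (Fin 2) ℂ) (B : GL (Fin 2) ℂ) : MvPolynomial (Fin 2) ℂ :=
  bind₁ (fun i => ∑ j, C ((B : Matrix (Fin 2) (Fin 2) ℂ) i j) * X j) P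

/-- `Aut(ℙ¹)_{P,Q}`: the projective automorphisms `φ` with `Q ∘ φ = c P` for some `c ≠ 0`. -/
def autForms (P Q : MvPolynomial (Fin 2) ℂ) : Set (PGL(Fin 2, ℂ)) :=
  {φ | ∃ B : GL (Fin 2) ℂ, Matrix.ProjGenLinGroup.mk B = φ ∧ ∃ c : ℂ, c ≠ 0 ∧ comp Q B = c • P}

/-- The set of zeros of a binary form on the projective line. -/
def zeros (P : MvPolynomial (Fin 2) ℂ) : Set P1 := {p | eval p.rep P = 0}

end SurfaceSim

end

namespace SurfaceSim

/-! ### Homogeneous polynomials and dehomogenization -/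

/-! An irreducible real polynomial vanishing on a real set of dimension two generates the vanishing
ideal of that set (`dvd_of_forall_eval_eq_zero`). Hence a similarity from `R` to `S` pulls the form
`G` back to a multiple of `F` (`exists_affSubst_eq`). At infinity the linear part multiplies
`absForm` by a constant, so the powers of `absForm` cancel and the reduced parts also correspond
(`exists_linSubst_eq`). The linear part preserves the absolute conic, and automorphisms of a conic
come from automorphisms of the line by the symmetric square (`exists_symSq_eq`,
`IsConicParam.exists_lift`); this gives an element of `autForms`.

Two similarities that agree on the conic differ by a symmetry of `R` whose linear part is a positive
scalar, that is, a translation or a homothety. If it is not the identity, its iterates have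
infinitely many points on each of the lines they sweep out, and `R` is a cylinder or a cone
(`eq_one_of_image_eq_of_smul`). This gives injectivity.

The pull-backs are nonzero because a real form vanishing on the conic is divisible by `absForm`.
Their zeros come in conjugate pairs, and the conic has no real point, so there are at least two. An
element of `PGL₂` is determined by the images of three points; with three zeros, `autForms`
therefore embeds in the maps between two finite sets. -/

theorem eval_smul_of_isHomogeneous {σ K : Type*} [Field K] {n : ℕ} {P : MvPolynomial σ K}
    (hP : P.IsHomogeneous n) (c : K) (v : σ → K) : eval (c • v) P = c ^ n * eval v P := by
  rw [eval_eq, eval_eq, Finset.mul_sum]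
  refine Finset.sum_congr rfl fun e he => ?_
  simp only [Pi.smul_apply, smul_eq_mul, mul_pow, Finset.prod_mul_distrib]
  rw [Finset.prod_pow_eq_pow_sum, show ∑ i ∈ e.support, e i = n by
    rw [hP.degree_eq_sum_deg_support he]]
  ring

/-- The cofactor of a nonzero homogeneous factor of a homogeneous polynomial is homogeneous. -/
theorem isHomogeneous_of_mul {σ K : Type*} [Field K] {k d : ℕ}
    {a b : MvPolynomial σ K} (ha : a.IsHomogeneous k) (ha0 : a ≠ 0) (hab : (a * b).IsHomogeneous d)
    (hb0 : b ≠ 0) : ∃ n, b.IsHomogeneous n := by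
  have hne : ∃ n, homogeneousComponent n b ≠ 0 := by
    by_contra! h
    apply hb0
    rw [← sum_homogeneousComponent b]
    exact Finset.sum_eq_zero fun i _ => h i
  have key : ∀ i, homogeneousComponent (k + i) (a * b) = a * homogeneousComponent i b := by
    intro i
    conv_lhs => rw [← sum_homogeneousComponent b, Finset.mul_sum, map_sum]
    have : ∀ j, homogeneousComponent (k + i) (a * homogeneousComponent j b) =
        if j = i then a * homogeneousComponent j b else 0 := by
      intro j
      rw [homogeneousComponent_of_mem (ha.mul (homogeneousComponent_isHomogeneous j b))]
      simp [eq_comm]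
    simp only [this]
    rw [Finset.sum_ite_eq']
    split_ifs with h
    · rfl
    · rw [homogeneousComponent_eq_zero, mul_zero]
      simpa using h
  obtain ⟨n, hn⟩ := hne
  have huniq : ∀ i, homogeneousComponent i b ≠ 0 → k + i = d := by
    intro i hi
    by_contra h
    have := key i
    rw [homogeneousComponent_of_mem hab, if_neg h] at this
    -- Multiplication by `a` shifts degrees by exactly `k`, so two nonzero components of `b` would
    -- give two of `a * b`.
    exact mul_ne_zero ha0 hi this.symm
  refine ⟨n, ?_⟩
  rw [← sum_homogeneousComponent b]
  refine IsHomogeneous.sum _ _ _ fun i _ => ?_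
  by_cases hi : homogeneousComponent i b = 0
  · rw [hi]; exact isHomogeneous_zero _ _ _
  · have := huniq i hi
    have := huniq n hn
    obtain rfl : i = n := by omega
    exact homogeneousComponent_isHomogeneous _ _

theorem totalDegree_aeval_le {σ τ K : Type*} [Field K] (g : σ → MvPolynomial τ K)
    (hg : ∀ i, (g i).totalDegree ≤ 1) (H : MvPolynomial σ K) :
    (aeval g H).totalDegree ≤ H.totalDegree := by
  rw [aeval_def, eval₂_eq]
  refine totalDegree_finsetSum_le fun e he => ?_
  refine (totalDegree_mul _ _).trans ?_
  rw [show totalDegree (algebraMap K (MvPolynomial τ K) (coeff e H)) = 0 from totalDegree_C _,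
    zero_add]
  refine (totalDegree_finsetProd _ _).trans (le_trans ?_ (le_totalDegree he))
  refine Finset.sum_le_sum fun i _ => (totalDegree_pow _ _).trans ?_
  exact (Nat.mul_le_mul_left _ (hg i)).trans (by simp)

/-- `F(1, x₁, x₂, x₃)`. -/
noncomputable def dehom : MvPolynomial (Fin 4) ℝ →ₐ[ℝ] MvPolynomial (Fin 3) ℝ :=
  aeval (Fin.cons 1 X : Fin 4 → MvPolynomial (Fin 3) ℝ)

theorem eval_aeval_cons {K : Type*} [Field K] {n : ℕ} (a : MvPolynomial (Fin n) K)
    (F : MvPolynomial (Fin (n + 1)) K) (x : Fin n → K) :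
    eval x (aeval (Fin.cons a X : Fin (n + 1) → MvPolynomial (Fin n) K) F) =
      eval (Fin.cons (eval x a) x : Fin (n + 1) → K) F := by
  induction F using MvPolynomial.induction_on with
  | C c => simp
  | add p q hp hq => rw [map_add, map_add, map_add, hp, hq]
  | mul_X p i hp =>
    rw [map_mul, map_mul, map_mul, hp, aeval_X, eval_X]
    refine Fin.cases ?_ (fun j => ?_) i <;> simp

theorem eval_dehom (F : MvPolynomial (Fin 4) ℝ) (x : E3) :
    eval x (dehom F) = eval (Fin.cons 1 x : Fin 4 → ℝ) F := by
  rw [dehom, eval_aeval_cons, map_one]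

theorem eval_atInfinity (F : MvPolynomial (Fin 4) ℝ) (x : E3) :
    eval x (atInfinity F) = eval (Fin.cons 0 x : Fin 4 → ℝ) F := by
  rw [atInfinity, eval_aeval_cons, map_zero]

/-- Scaling reduces every point with `x 0 ≠ 0` to the affine chart; the factor `X 0` covers the
remaining points. -/
theorem eq_zero_of_dehom_eq_zero {d : ℕ} {H : MvPolynomial (Fin 4) ℝ} (hH : H.IsHomogeneous d)
    (h : dehom H = 0) : H = 0 := by
  have : X 0 * H = 0 := by
    apply MvPolynomial.funext
    intro x
    simp only [map_mul, eval_X, map_zero]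
    by_cases hx : x 0 = 0
    · simp [hx]
    · have h1 := eval_dehom H ((x 0)⁻¹ • Fin.tail x)
      have h2 : x = x 0 • (Fin.cons 1 ((x 0)⁻¹ • Fin.tail x) : Fin 4 → ℝ) := by
        ext i
        refine Fin.cases ?_ (fun j => ?_) i <;> simp [Fin.tail, hx]
      rw [h, map_zero] at h1
      rw [h2, eval_smul_of_isHomogeneous hH, ← h1]
      simp
  exact (mul_eq_zero.1 this).resolve_left (X_ne_zero 0)

theorem eq_of_dehom_eq {d : ℕ} {H K : MvPolynomial (Fin 4) ℝ} (hH : H.IsHomogeneous d)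
    (hK : K.IsHomogeneous d) (h : dehom H = dehom K) : H = K :=
  sub_eq_zero.1 (eq_zero_of_dehom_eq_zero (hH.sub hK) (by rw [map_sub, h, sub_self]))

theorem totalDegree_dehom_le {d : ℕ} {H : MvPolynomial (Fin 4) ℝ} (hH : H.IsHomogeneous d) :
    (dehom H).totalDegree ≤ d := by
  refine (totalDegree_aeval_le _ (fun i => ?_) H).trans hH.totalDegree_le
  refine Fin.cases ?_ (fun j => ?_) i <;> simp

theorem dehom_X_zero : dehom (X 0) = 1 := by simp [dehom]

theorem exists_homogenization (a : MvPolynomial (Fin 3) ℝ) :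
    ∃ A : MvPolynomial (Fin 4) ℝ, A.IsHomogeneous a.totalDegree ∧ dehom A = a := by
  set n := a.totalDegree with hn
  refine ⟨∑ i ∈ Finset.range (n + 1),
    X 0 ^ (n - i) * rename Fin.succ (homogeneousComponent i a), ?_, ?_⟩
  · refine IsHomogeneous.sum _ _ _ fun i hi => ?_
    have hi' : i ≤ n := by simpa [Nat.lt_succ_iff] using hi
    have := (isHomogeneous_X_pow (R := ℝ) (0 : Fin 4) (n - i)).mul
      ((homogeneousComponent_isHomogeneous i a).rename_isHomogeneous (f := Fin.succ))
    rwa [Nat.sub_add_cancel hi'] at this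
  · conv_rhs => rw [← sum_homogeneousComponent a]
    rw [map_sum]
    refine Finset.sum_congr rfl fun i _ => ?_
    rw [map_mul, map_pow, dehom_X_zero, one_pow, one_mul, dehom, aeval_rename]
    exact aeval_X_left_apply _

theorem irreducible_of_irreducible_map {σ : Type*} {F : MvPolynomial σ ℝ}
    (hF : Irreducible (map (algebraMap ℝ ℂ) F)) : Irreducible F := by
  have aux : ∀ a : MvPolynomial σ ℝ, IsUnit (map (algebraMap ℝ ℂ) a) → IsUnit a := by
    intro a ha
    rw [isUnit_iff_eq_C_of_isReduced] at ha ⊢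
    obtain ⟨r, hr, hr'⟩ := ha
    have h0 : a.totalDegree = 0 := by
      have := totalDegree_C (σ := σ) r
      rw [← hr', totalDegree, support_map_of_injective _ (algebraMap ℝ ℂ).injective] at this
      exact this
    rw [totalDegree_eq_zero_iff_eq_C] at h0
    refine ⟨_, ?_, h0⟩
    rw [isUnit_iff_ne_zero]
    intro hc
    rw [hc, map_zero] at h0
    rw [h0, map_zero] at hr'
    rw [eq_comm, ← map_zero (C (σ := σ) (R := ℂ))] at hr'
    exact hr.ne_zero (C_injective _ _ hr')
  refine ⟨fun h => hF.not_isUnit (h.map _), fun a b h => ?_⟩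
  rw [h, map_mul] at hF
  exact (hF.isUnit_or_isUnit rfl).imp (aux a) (aux b)

/-- The homogenizations of two factors multiply to `F` up to a power of `X 0`, which is absorbed
into one of them and dehomogenizes to 1. -/
theorem irreducible_dehom {d : ℕ} {F : MvPolynomial (Fin 4) ℝ} (hF : F.IsHomogeneous d)
    (hirr : Irreducible F) (hu : ¬ IsUnit (dehom F)) : Irreducible (dehom F) := by
  refine ⟨hu, fun a b h => ?_⟩
  have hf0 : dehom F ≠ 0 := fun h => hirr.ne_zero (eq_zero_of_dehom_eq_zero hF h)
  have hab := totalDegree_mul_of_isDomain (left_ne_zero_of_mul (h ▸ hf0))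
    (right_ne_zero_of_mul (h ▸ hf0))
  have hle := totalDegree_dehom_le hF
  rw [h, hab] at hle
  obtain ⟨A, hA, rfl⟩ := exists_homogenization a
  obtain ⟨B, hB, rfl⟩ := exists_homogenization b
  have hfac : F = A * (B * X 0 ^ (d - ((dehom A).totalDegree + (dehom B).totalDegree))) := by
    refine eq_of_dehom_eq hF ?_ (by simp [h, dehom_X_zero])
    have := (hA.mul hB).mul (isHomogeneous_X_pow (R := ℝ) (0 : Fin 4)
      (d - ((dehom A).totalDegree + (dehom B).totalDegree)))
    rwa [Nat.add_sub_cancel' hle, mul_assoc] at this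
  refine (hirr.isUnit_or_isUnit hfac).imp (fun h => h.map dehom) fun h => ?_
  simpa [dehom_X_zero] using h.map dehom

/-- If the dehomogenization of an irreducible form divides that of a form of the same degree,
then the two forms are proportional. -/
theorem eq_C_mul_of_dehom_dvd {d : ℕ} {F H : MvPolynomial (Fin 4) ℝ} (hF : F.IsHomogeneous d)
    (hH : H.IsHomogeneous d) (hirr : Irreducible F) (hu : ¬ IsUnit (dehom F)) (hH0 : H ≠ 0)
    (hdvd : dehom F ∣ dehom H) : ∃ c : ℝ, c ≠ 0 ∧ H = C c * F := by
  have hf0 : dehom F ≠ 0 := fun h => hirr.ne_zero (eq_zero_of_dehom_eq_zero hF h)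
  have hh0 : dehom H ≠ 0 := fun h => hH0 (eq_zero_of_dehom_eq_zero hH h)
  -- A drop in degree would split a power of `X 0` off `F`, leaving a unit as the other factor.
  have hdeg : (dehom F).totalDegree = d := by
    have hle := totalDegree_dehom_le hF
    obtain ⟨A, hA, hAF⟩ := exists_homogenization (dehom F)
    have hfac : F = A * X 0 ^ (d - (dehom F).totalDegree) := by
      refine eq_of_dehom_eq hF ?_ (by simp [hAF, dehom_X_zero])
      have := hA.mul (isHomogeneous_X_pow (R := ℝ) (0 : Fin 4) (d - (dehom F).totalDegree))
      rwa [Nat.add_sub_cancel' hle] at this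
    rcases hirr.isUnit_or_isUnit hfac with h | h
    · exact absurd (hAF ▸ h.map dehom) hu
    · have := (isUnit_iff_totalDegree_of_isReduced.1 h).2
      rw [totalDegree_X_pow] at this
      omega
  obtain ⟨k, hk⟩ := hdvd
  have hk0 : k ≠ 0 := right_ne_zero_of_mul (hk ▸ hh0)
  have hle := totalDegree_dehom_le hH
  rw [hk, totalDegree_mul_of_isDomain hf0 hk0, hdeg] at hle
  have hkC := totalDegree_eq_zero_iff_eq_C.1 (show k.totalDegree = 0 by omega)
  refine ⟨coeff 0 k, fun h => hk0 (by rw [hkC, h, map_zero]), ?_⟩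
  refine eq_of_dehom_eq hH (hF.C_mul _) ?_
  rw [hk, map_mul, mul_comm, show dehom (C (coeff 0 k)) = C (coeff 0 k) from AlgHom.commutes _ _,
    ← hkC]

/-! ### The vanishing ideal of a two-dimensional real surface -/

theorem not_isUnit_of_realDim {f : MvPolynomial (Fin 3) ℝ} {A : Set E3}
    (hf : ∀ x ∈ A, eval x f = 0) (hdim : realDim A = 2) : ¬ IsUnit f := by
  intro hu
  have htop : (vanishingIdeal ℝ A : Ideal (MvPolynomial (Fin 3) ℝ)) = ⊤ :=
    Ideal.eq_top_of_isUnit_mem _ (mem_vanishingIdeal_iff.2 fun x hx => by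
      rw [← hf x hx]; rfl) hu
  have := Ideal.Quotient.subsingleton_iff.2 htop
  rw [realDim, ringKrullDim_eq_bot_of_subsingleton] at hdim
  exact absurd hdim (by decide)

/-- Dimension count: if `f ∤ h`, then `f` and afterwards `h` each lower the Krull dimension of the
polynomial ring by at least one, so the vanishing ideal has a quotient of dimension at most 3 - 1 -
1. -/
theorem dvd_of_forall_eval_eq_zero {f h : MvPolynomial (Fin 3) ℝ} {A : Set E3}
    (hirr : Irreducible f) (hf : ∀ x ∈ A, eval x f = 0) (hdim : realDim A = 2)
    (hh : ∀ x ∈ A, eval x h = 0) : f ∣ h := by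
  by_contra hndvd
  set I : Ideal (MvPolynomial (Fin 3) ℝ) := vanishingIdeal ℝ A
  set J : Ideal (MvPolynomial (Fin 3) ℝ) := Ideal.span {f}
  have hfI : f ∈ I := mem_vanishingIdeal_iff.2 fun x hx => by rw [← hf x hx]; rfl
  have hhI : h ∈ I := mem_vanishingIdeal_iff.2 fun x hx => by rw [← hh x hx]; rfl
  have hJ : J.IsPrime := (Ideal.span_singleton_prime hirr.ne_zero).2 hirr.prime
  have h1 : ringKrullDim (MvPolynomial (Fin 3) ℝ ⧸ J) + 1 ≤ 3 := by
    refine (ringKrullDim_quotient_succ_le_of_nonZeroDivisor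
      (mem_nonZeroDivisors_of_ne_zero hirr.ne_zero)).trans ?_
    rw [MvPolynomial.ringKrullDim_of_isNoetherianRing, ringKrullDim_eq_zero_of_field]
    simp
  set h' : MvPolynomial (Fin 3) ℝ ⧸ J := Ideal.Quotient.mk J h
  have hh' : h' ≠ 0 := by
    rw [Ne, Ideal.Quotient.eq_zero_iff_mem, Ideal.mem_span_singleton]
    exact hndvd
  have h2 := ringKrullDim_quotient_succ_le_of_nonZeroDivisor (mem_nonZeroDivisors_of_ne_zero hh')
  have hJI : J ≤ I := (Ideal.span_singleton_le_iff_mem _).2 hfI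
  have h3 : ringKrullDim (MvPolynomial (Fin 3) ℝ ⧸ I) ≤
      ringKrullDim ((MvPolynomial (Fin 3) ℝ ⧸ J) ⧸ Ideal.span {h'}) := by
    refine ringKrullDim_le_of_surjective (Ideal.Quotient.lift _ (Ideal.Quotient.factor hJI) ?_) ?_
    · intro a ha
      obtain ⟨b, rfl⟩ := Ideal.mem_span_singleton.1 ha
      rw [map_mul, Ideal.Quotient.factor_mk, Ideal.Quotient.eq_zero_iff_mem.2 hhI, zero_mul]
    · exact Ideal.Quotient.lift_surjective_of_surjective _ _
        (Ideal.Quotient.factor_surjective hJI)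
  rw [realDim] at hdim
  rw [hdim] at h3
  have h4 : (2 : WithBot ℕ∞) + 1 + 1 ≤ 3 :=
    (add_le_add_left ((add_le_add_left h3 1).trans h2) 1).trans h1
  exact absurd h4 (by decide)

/-! ### Similarities acting on forms -/

theorem eval_aeval_eq {σ τ K : Type*} [Field K] (g : σ → MvPolynomial τ K)
    (p : MvPolynomial σ K) (v : τ → K) :
    eval v (aeval g p) = eval (fun i => eval v (g i)) p := by
  induction p using MvPolynomial.induction_on with
  | C c => simp
  | add p q hp hq => rw [map_add, map_add, map_add, hp, hq]
  | mul_X p i hp => rw [map_mul, map_mul, map_mul, hp, aeval_X, eval_X]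

/-- Substitution of the linear forms given by the rows of a matrix. -/
noncomputable def linSubst {n : ℕ} {K : Type*} [Field K] (M : Matrix (Fin n) (Fin n) K) :
    MvPolynomial (Fin n) K →ₐ[K] MvPolynomial (Fin n) K :=
  aeval fun i => ∑ j, C (M i j) * X j

theorem eval_linSubst {n : ℕ} {K : Type*} [Field K] (M : Matrix (Fin n) (Fin n) K)
    (p : MvPolynomial (Fin n) K) (v : Fin n → K) :
    eval v (linSubst M p) = eval (M.mulVec v) p := by
  rw [linSubst, eval_aeval_eq]
  congr 2
  ext i
  simp [Matrix.mulVec, dotProduct]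

theorem linSubst_linSubst {n : ℕ} {K : Type*} [Field K] [Infinite K]
    (M N : Matrix (Fin n) (Fin n) K) (p : MvPolynomial (Fin n) K) :
    linSubst M (linSubst N p) = linSubst (N * M) p := by
  apply MvPolynomial.funext
  intro v
  rw [eval_linSubst, eval_linSubst, eval_linSubst, Matrix.mulVec_mulVec]

theorem linSubst_one {n : ℕ} {K : Type*} [Field K] [Infinite K] (p : MvPolynomial (Fin n) K) :
    linSubst 1 p = p := by
  apply MvPolynomial.funext
  intro v
  rw [eval_linSubst, Matrix.one_mulVec]

theorem map_linSubst {n : ℕ} (M : Matrix (Fin n) (Fin n) ℝ) (p : MvPolynomial (Fin n) ℝ) :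
    map (algebraMap ℝ ℂ) (linSubst M p) =
      linSubst (M.map (algebraMap ℝ ℂ)) (map (algebraMap ℝ ℂ) p) := by
  induction p using MvPolynomial.induction_on with
  | C c => simp [linSubst]
  | add p q hp hq => simp only [map_add, hp, hq]
  | mul_X p i hp =>
    rw [map_mul, map_mul, map_mul, map_mul, hp, map_X]
    simp [linSubst]

theorem linMatrix_mulVec (ψ : E3 ≃ᵃ[ℝ] E3) (x : E3) :
    (linMatrix ψ : Matrix (Fin 3) (Fin 3) ℝ).mulVec x = ψ.linear x := by
  rw [← Matrix.toLin'_apply]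
  have : Matrix.toLin' (linMatrix ψ : Matrix (Fin 3) (Fin 3) ℝ) = ψ.linear.toLinearMap := by
    have h : Matrix.GeneralLinearGroup.toLin (linMatrix ψ) =
        (LinearMap.GeneralLinearGroup.generalLinearEquiv ℝ E3).symm ψ.linear := by
      simp only [linMatrix, MonoidHom.comp_apply]
      exact MulEquiv.apply_symm_apply _ _
    have h2 := congrArg (fun u : LinearMap.GeneralLinearGroup ℝ E3 => (u : E3 →ₗ[ℝ] E3)) h
    exact h2
  rw [this]; rfl

theorem apply_eq_mulVec_add (ψ : E3 ≃ᵃ[ℝ] E3) (x : E3) :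
    ψ x = (linMatrix ψ : Matrix (Fin 3) (Fin 3) ℝ).mulVec x + ψ 0 := by
  rw [linMatrix_mulVec]
  simpa using ψ.map_vadd 0 x

/-- The linear substitution `(x₀, x) ↦ (x₀, M x + x₀ b)`. -/
noncomputable def affSubst (M : Matrix (Fin 3) (Fin 3) ℝ) (b : E3) :
    MvPolynomial (Fin 4) ℝ →ₐ[ℝ] MvPolynomial (Fin 4) ℝ :=
  aeval (Fin.cons (X 0) fun i => ∑ j, C (M i j) * X (Fin.succ j) + C (b i) * X 0)

theorem eval_affSubst (M : Matrix (Fin 3) (Fin 3) ℝ) (b : E3) (G : MvPolynomial (Fin 4) ℝ)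
    (t : ℝ) (x : E3) : eval (Fin.cons t x : Fin 4 → ℝ) (affSubst M b G) =
      eval (Fin.cons t (M.mulVec x + t • b) : Fin 4 → ℝ) G := by
  rw [affSubst, eval_aeval_eq]
  congr 2
  ext i
  refine Fin.cases ?_ (fun j => ?_) i
  · simp
  · simp [Matrix.mulVec, dotProduct, mul_comm]

theorem isHomogeneous_affSubst {d : ℕ} {G : MvPolynomial (Fin 4) ℝ} (hG : G.IsHomogeneous d)
    (M : Matrix (Fin 3) (Fin 3) ℝ) (b : E3) : (affSubst M b G).IsHomogeneous d := by
  have := hG.aeval (Fin.cons (X 0) fun i => ∑ j, C (M i j) * X (Fin.succ j) + C (b i) * X 0 :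
    Fin 4 → MvPolynomial (Fin 4) ℝ) (n := 1) (fun i => ?_)
  · simpa [affSubst] using this
  · refine Fin.cases ?_ (fun j => ?_) i
    · exact isHomogeneous_X _ _
    · exact (IsHomogeneous.sum _ _ _ fun j _ => isHomogeneous_C_mul_X _ _).add
        (isHomogeneous_C_mul_X _ _)

/-- A similarity mapping one real surface onto another maps the defining forms to each other. -/
theorem exists_affSubst_eq {d : ℕ} {F G : MvPolynomial (Fin 4) ℝ} (hF : IsSurfaceForm d F)
    (hG : IsSurfaceForm d G) (ψ : E3 ≃ᵃ[ℝ] E3) (hψ : ψ '' realLocus F = realLocus G) :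
    ∃ c : ℝ, c ≠ 0 ∧
      affSubst (linMatrix ψ : Matrix (Fin 3) (Fin 3) ℝ) (ψ 0) G = C c * F := by
  have hev : ∀ x, eval x (dehom (affSubst (linMatrix ψ : Matrix (Fin 3) (Fin 3) ℝ) (ψ 0) G)) =
      eval (ψ x) (dehom G) := by
    intro x
    rw [eval_dehom, eval_dehom, eval_affSubst, apply_eq_mulVec_add ψ x, one_smul]
  have hirr := irreducible_of_irreducible_map hF.irreducible
  have hfR : ∀ x ∈ realLocus F, eval x (dehom F) = 0 := fun x hx => by
    rw [eval_dehom]; exact hx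
  have hu := not_isUnit_of_realDim hfR hF.dim
  refine eq_C_mul_of_dehom_dvd hF.isHomogeneous (isHomogeneous_affSubst hG.isHomogeneous _ _)
    hirr hu ?_ ?_
  · intro h0
    refine (irreducible_of_irreducible_map hG.irreducible).ne_zero
      (eq_zero_of_dehom_eq_zero hG.isHomogeneous (MvPolynomial.funext fun y => ?_))
    have := hev (ψ.symm y)
    rw [h0, map_zero, map_zero, AffineEquiv.apply_symm_apply] at this
    rw [← this, map_zero]
  · refine dvd_of_forall_eval_eq_zero (irreducible_dehom hF.isHomogeneous hirr hu) hfR hF.dim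
      fun x hx => ?_
    rw [hev, eval_dehom]
    have : ψ x ∈ realLocus G := hψ ▸ Set.mem_image_of_mem _ hx
    exact this

theorem eval_absForm (x : E3) : eval x absForm = x ⬝ᵥ x := by
  simp [absForm, dotProduct, sq]

theorem linSubst_absForm {M : Matrix (Fin 3) (Fin 3) ℝ} {a : ℝ} (h : M.transpose * M = a • 1) :
    linSubst M absForm = C a * absForm := by
  apply MvPolynomial.funext
  intro x
  rw [eval_linSubst, map_mul, eval_C, eval_absForm, eval_absForm, Matrix.dotProduct_mulVec,
    Matrix.vecMul_mulVec, h]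
  simp [Matrix.vecMul_smul]

theorem absForm_ne_zero : absForm ≠ 0 := by
  intro h
  have := eval_absForm (fun _ => 1)
  rw [h] at this
  simp [dotProduct] at this

theorem linSubst_atInfinity {F G : MvPolynomial (Fin 4) ℝ} {M : Matrix (Fin 3) (Fin 3) ℝ}
    {b : E3} {c : ℝ} (h : affSubst M b G = C c * F) :
    linSubst M (atInfinity G) = C c * atInfinity F := by
  apply MvPolynomial.funext
  intro x
  have := eval_affSubst M b G 0 x
  rw [h, map_mul, eval_C, zero_smul, add_zero] at this
  rw [eval_linSubst, map_mul, eval_C, eval_atInfinity, eval_atInfinity, this]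

/-- Both exponents count the full power of `q`, hence they agree. -/
theorem pow_mul_cancel {σ K : Type*} [Field K] {q p p' : MvPolynomial σ K} {k l : ℕ} (hq : q ≠ 0)
    (hp : ¬ q ∣ p) (hp' : ¬ q ∣ p') (h : q ^ k * p = q ^ l * p') : p = p' := by
  have aux : ∀ {k l : ℕ} {p p' : MvPolynomial σ K}, ¬ q ∣ p → q ^ k * p = q ^ l * p' → l ≤ k := by
    intro k l p p' hp h
    by_contra! hlt
    obtain ⟨e, rfl⟩ := Nat.exists_eq_add_of_lt hlt
    rw [add_assoc, pow_add, mul_assoc] at h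
    apply hp
    rw [mul_left_cancel₀ (pow_ne_zero _ hq) h, pow_succ, mul_comm _ q, mul_assoc]
    exact dvd_mul_right _ _
  obtain rfl := le_antisymm (aux hp' h.symm) (aux hp h)
  exact mul_left_cancel₀ (pow_ne_zero _ hq) h

/-- A similarity mapping one surface onto another maps the reduced parts at infinity to each
other. -/
theorem exists_linSubst_eq {F G : MvPolynomial (Fin 4) ℝ} {Ft Gt : MvPolynomial (Fin 3) ℝ}
    (hFt : IsReducedInfinityPart F Ft) (hGt : IsReducedInfinityPart G Gt)
    {A : GL (Fin 3) ℝ} (hA : A ∈ similitude) {c : ℝ} (hc : c ≠ 0)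
    (h : linSubst (A : Matrix (Fin 3) (Fin 3) ℝ) (atInfinity G) = C c * atInfinity F) :
    ∃ c' : ℝ, c' ≠ 0 ∧ linSubst (A : Matrix (Fin 3) (Fin 3) ℝ) Gt = C c' * Ft := by
  obtain ⟨⟨k, hk⟩, hFd⟩ := hFt
  obtain ⟨⟨l, hl⟩, hGd⟩ := hGt
  obtain ⟨⟨a', ha', hAA'⟩, -⟩ := similitude.inv_mem hA
  obtain ⟨⟨a, ha, hAA⟩, -⟩ := hA
  have hinv : linSubst ((A⁻¹ : GL (Fin 3) ℝ) : Matrix (Fin 3) (Fin 3) ℝ)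
      (linSubst (A : Matrix (Fin 3) (Fin 3) ℝ) Gt) = Gt := by
    rw [linSubst_linSubst, ← Units.val_mul, mul_inv_cancel, Units.val_one, linSubst_one]
  have hunit : ∀ {r : ℝ}, r ≠ 0 → IsUnit (C r : MvPolynomial (Fin 3) ℝ) := fun hr =>
    (isUnit_iff_ne_zero.2 hr).map C
  have hd1 : ¬ absForm ∣ linSubst (A : Matrix (Fin 3) (Fin 3) ℝ) Gt := by
    intro hd
    have := map_dvd (linSubst ((A⁻¹ : GL (Fin 3) ℝ) : Matrix (Fin 3) (Fin 3) ℝ)) hd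
    rw [hinv, linSubst_absForm hAA', (hunit ha'.ne').mul_left_dvd] at this
    exact hGd this
  have hal : a ^ l ≠ 0 := pow_ne_zero _ ha.ne'
  -- The substitution turns `absForm ^ l` into `a ^ l` times itself.
  refine ⟨c / a ^ l, div_ne_zero hc hal, ?_⟩
  rw [hl, hk, map_mul, map_pow, linSubst_absForm hAA, mul_pow] at h
  refine pow_mul_cancel (k := l) (l := k) absForm_ne_zero hd1 ?_ ?_
  · rwa [(hunit (div_ne_zero hc hal)).dvd_mul_left]
  · refine mul_left_cancel₀ (hunit hal).ne_zero ?_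
    rw [C_pow, ← mul_assoc, h, div_eq_mul_inv, C_mul]
    have : (C a : MvPolynomial (Fin 3) ℝ) ^ l * C (a ^ l)⁻¹ = 1 := by
      rw [← C_pow, ← C_mul, mul_inv_cancel₀ hal, C_1]
    linear_combination (-C c * absForm ^ k * Ft) * this

/-! ### Symmetries of a surface that are translations or homotheties -/

/-- On a line `f` is a polynomial in one variable, and it has infinitely many roots. -/
theorem eval_line_eq_zero {σ : Type*} (f : MvPolynomial σ ℝ) (x b : σ → ℝ) {T : Set ℝ}
    (hT : T.Infinite) (h : ∀ t ∈ T, eval (x + t • b) f = 0) (t : ℝ) : eval (x + t • b) f = 0 := by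
  set p : Polynomial ℝ := aeval (fun i => Polynomial.C (x i) + Polynomial.C (b i) * Polynomial.X) f
  have hp : ∀ t : ℝ, p.eval t = eval (x + t • b) f := by
    intro t
    have : ∀ f : MvPolynomial σ ℝ, (aeval (fun i => Polynomial.C (x i) +
        Polynomial.C (b i) * Polynomial.X) f).eval t = eval (x + t • b) f := by
      intro f
      induction f using MvPolynomial.induction_on with
      | C c => simp
      | add p q hp hq => rw [map_add, Polynomial.eval_add, map_add, hp, hq]
      | mul_X p i hp =>
        rw [map_mul, Polynomial.eval_mul, map_mul, hp, aeval_X, eval_X]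
        simp only [Polynomial.eval_add, Polynomial.eval_mul, Polynomial.eval_C, Polynomial.eval_X,
          Pi.add_apply, Pi.smul_apply, smul_eq_mul, mul_comm t]
    exact this f
  have hp0 : p = 0 := Polynomial.eq_zero_of_infinite_isRoot p
    (hT.mono fun t ht => by
      rw [Set.mem_ofPred_eq, Polynomial.IsRoot, hp, h t ht])
  rw [← hp, hp0, Polynomial.eval_zero]

theorem image_eq_of_subset_of_inverse {α : Type*} {A : Set α} {g g' : α → α}
    (h : ∀ x ∈ A, g x ∈ A) (h' : ∀ x ∈ A, g' x ∈ A) (hgg' : ∀ x, g (g' x) = x) : g '' A = A :=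
  Set.Subset.antisymm (Set.image_subset_iff.2 h) fun x hx => ⟨g' x, h' x hx, hgg' x⟩

theorem eq_one_of_image_eq_of_smul {F : MvPolynomial (Fin 4) ℝ} (hcyl : ¬ IsCylinder (realLocus F))
    (hcone : ¬ IsCone (realLocus F)) (φ : E3 ≃ᵃ[ℝ] E3) (hφ : φ '' realLocus F = realLocus F)
    {r : ℝ} (hr : 0 < r) (hlin : ∀ x, φ x = r • x + φ 0) : φ = 1 := by
  have hmem : ∀ x, x ∈ realLocus F ↔ eval x (dehom F) = 0 := fun x => by
    rw [eval_dehom]; rfl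
  have hmap : ∀ x ∈ realLocus F, φ x ∈ realLocus F := fun x hx => by
    have := Set.mem_image_of_mem φ hx
    rwa [hφ] at this
  by_cases hr1 : r = 1
  · subst hr1
    by_cases hb : φ 0 = 0
    · ext x : 1
      rw [hlin, hb]; simp
    · refine absurd ⟨φ 0, hb, fun t => ?_⟩ hcyl
      have key : ∀ x ∈ realLocus F, ∀ t : ℝ, x + t • φ 0 ∈ realLocus F := by
        intro x hx t
        rw [hmem]
        refine eval_line_eq_zero _ _ _ (T := Set.range (fun n : ℕ => (n : ℝ)))
          (Set.infinite_range_of_injective Nat.cast_injective) ?_ t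
        rintro _ ⟨n, rfl⟩
        rw [← hmem]
        induction n with
        | zero => simpa using hx
        | succ n ih =>
          have := hmap _ ih
          rw [hlin] at this
          convert this using 1
          push_cast
          module
      exact image_eq_of_subset_of_inverse (g' := fun x => x + (-t) • φ 0) (fun x hx => key x hx t)
        (fun x hx => key x hx (-t)) (fun x => by module)
  · have h1r : 1 - r ≠ 0 := sub_ne_zero.2 (Ne.symm hr1)
    -- The fixed point of `φ`, which is the centre of the homothety.
    set c : E3 := (1 - r)⁻¹ • φ 0 with hc
    have hb : φ 0 = (1 - r) • c := by rw [hc, smul_smul, mul_inv_cancel₀ h1r, one_smul]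
    refine absurd ⟨c, fun t ht => ?_⟩ hcone
    have key : ∀ x ∈ realLocus F, ∀ t : ℝ, c + t • (x - c) ∈ realLocus F := by
      intro x hx t
      rw [hmem]
      refine eval_line_eq_zero _ _ _ (T := Set.range (fun n : ℕ => r ^ n))
        (Set.infinite_range_of_injective (pow_right_injective₀ hr hr1)) ?_ t
      rintro _ ⟨n, rfl⟩
      rw [← hmem]
      induction n with
      | zero => simpa using hx
      | succ n ih =>
        have := hmap _ ih
        rw [hlin, hb] at this
        convert this using 1
        simp only [pow_succ]
        module
    refine image_eq_of_subset_of_inverse (g' := fun x => c + t⁻¹ • (x - c))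
      (fun x hx => key x hx t) (fun x hx => key x hx t⁻¹) (fun x => ?_)
    simp [smul_smul, ht]

/-- A real matrix fixing every point of the absolute conic is scalar. -/
theorem eq_smul_one_of_fixes_absConic (A : Matrix (Fin 3) (Fin 3) ℝ)
    (h : ∀ v : Fin 3 → ℂ, v ≠ 0 → v ⬝ᵥ v = 0 →
      ∃ c : ℂ, (A.map (algebraMap ℝ ℂ)).mulVec v = c • v) :
    ∃ r : ℝ, A = r • 1 := by
  -- Since `A` is real, the real and imaginary parts at three isotropic vectors give enough linear
  -- equations to force all entries.
  have h1 := h ![1, Complex.I, 0] (fun h => by simpa using congrFun h 0) (by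
    simp [dotProduct, Fin.sum_univ_three])
  have h2 := h ![0, 1, Complex.I] (fun h => by simpa using congrFun h 1) (by
    simp [dotProduct, Fin.sum_univ_three])
  have h3 := h ![1, 0, Complex.I] (fun h => by simpa using congrFun h 0) (by
    simp [dotProduct, Fin.sum_univ_three])
  obtain ⟨c1, h1⟩ := h1
  obtain ⟨c2, h2⟩ := h2
  obtain ⟨c3, h3⟩ := h3
  have g : ∀ i, _ := fun i => congrFun h1 i
  have g' : ∀ i, _ := fun i => congrFun h2 i
  have g'' : ∀ i, _ := fun i => congrFun h3 i
  simp [Matrix.mulVec, dotProduct, Fin.sum_univ_three, Fin.forall_fin_succ, Complex.ext_iff]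
    at g g' g''
  refine ⟨A 0 0, ?_⟩
  ext i j
  fin_cases i <;> fin_cases j <;> simp <;> linarith

/-! ### The pull-back to the conic -/

theorem eval_pullback (m : Fin 3 → MvPolynomial (Fin 2) ℂ) (H : MvPolynomial (Fin 3) ℝ)
    (v : Fin 2 → ℂ) :
    eval v (pullback m H) = eval (fun i => eval v (m i)) (map (algebraMap ℝ ℂ) H) :=
  eval_aeval_eq m _ v

theorem isHomogeneous_pullback {m : Fin 3 → MvPolynomial (Fin 2) ℂ}
    (hm : ∀ i, (m i).IsHomogeneous 2) {H : MvPolynomial (Fin 3) ℝ} {n : ℕ}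
    (hH : H.IsHomogeneous n) : (pullback m H).IsHomogeneous (2 * n) :=
  (hH.map (algebraMap ℝ ℂ)).aeval m hm

/-- Surjectivity passes from points to vectors: the scalar by which a preimage is off is a square,
and `m` is quadratic. -/
theorem IsConicParam.exists_eval_eq {μ : P1 → PInf} {m : Fin 3 → MvPolynomial (Fin 2) ℂ}
    (hμ : IsConicParam μ m) {w : Fin 3 → ℂ} (hw : w ⬝ᵥ w = 0) :
    ∃ v : Fin 2 → ℂ, (fun i => eval v (m i)) = w := by
  by_cases hw0 : w = 0
  · refine ⟨0, ?_⟩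
    ext i
    have := eval_smul_of_isHomogeneous (hμ.isHomogeneous i) 0 0
    simp only [zero_smul] at this
    rw [this, hw0]; simp
  obtain ⟨p, -, hp⟩ := hμ.bijOn.surjOn
    (show Projectivization.mk ℂ w hw0 ∈ absConic from hw)
  induction p using Projectivization.ind with
  | h v hv =>
    obtain ⟨hne, he⟩ := hμ.map_mk v hv
    rw [hp, Projectivization.mk_eq_mk_iff'] at he
    obtain ⟨a, ha⟩ := he
    obtain ⟨s, hs⟩ := IsAlgClosed.exists_eq_mul_self a
    refine ⟨s • v, ?_⟩
    rw [← ha]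
    ext i
    rw [eval_smul_of_isHomogeneous (hμ.isHomogeneous i), Pi.smul_apply, smul_eq_mul, hs, sq]

theorem IsConicParam.dotProduct_eval {μ : P1 → PInf} {m : Fin 3 → MvPolynomial (Fin 2) ℂ}
    (hμ : IsConicParam μ m) {v : Fin 2 → ℂ} (hv : v ≠ 0) :
    (fun i => eval v (m i)) ⬝ᵥ (fun i => eval v (m i)) = 0 := by
  obtain ⟨hne, he⟩ := hμ.map_mk v hv
  have := hμ.bijOn.mapsTo (Set.mem_univ (Projectivization.mk ℂ v hv))
  rw [he] at this
  exact this

/-- Division with remainder by `absForm`, which is monic quadratic in `X 0`. -/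
theorem exists_division (H : MvPolynomial (Fin 3) ℝ) :
    ∃ (K : MvPolynomial (Fin 3) ℝ) (A B : MvPolynomial (Fin 2) ℝ),
      H = absForm * K + rename Fin.succ A + X 0 * rename Fin.succ B := by
  induction H using MvPolynomial.induction_on with
  | C c => exact ⟨0, C c, 0, by simp⟩
  | add p q hp hq =>
    obtain ⟨K, A, B, h⟩ := hp
    obtain ⟨K', A', B', h'⟩ := hq
    refine ⟨K + K', A + A', B + B', ?_⟩
    rw [map_add, map_add]
    linear_combination h + h'
  | mul_X p i hp =>
    obtain ⟨K, A, B, h⟩ := hp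
    refine Fin.cases ?_ (fun j => ?_) i
    · refine ⟨K * X 0 + rename Fin.succ B, -(X 0 ^ 2 + X 1 ^ 2) * B, A, ?_⟩
      have : (absForm : MvPolynomial (Fin 3) ℝ) = X 0 ^ 2 + X 1 ^ 2 + X 2 ^ 2 := by
        simp [absForm, Fin.sum_univ_three]
      simp only [map_mul, map_neg, map_add, map_pow, rename_X, h, this]
      rw [show (Fin.succ 0 : Fin 3) = 1 from rfl, show (Fin.succ 1 : Fin 3) = 2 from rfl]
      ring
    · refine ⟨K * X j.succ, A * X j, B * X j, ?_⟩
      simp only [map_mul, rename_X, h]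
      ring

/-- The remainder `A + x₀ B` vanishes at both square roots `x₀ = ±s` of `-(x₁² + x₂²)`; the sum and
the difference of the two equations kill `A` and `B`. -/
theorem absForm_dvd_of_pullback_eq_zero {μ : P1 → PInf} {m : Fin 3 → MvPolynomial (Fin 2) ℂ}
    (hμ : IsConicParam μ m) {H : MvPolynomial (Fin 3) ℝ} (h : pullback m H = 0) :
    absForm ∣ H := by
  obtain ⟨K, A, B, hH⟩ := exists_division H
  have hcone : ∀ w : Fin 3 → ℂ, w ⬝ᵥ w = 0 →
      eval (Fin.tail w) (map (algebraMap ℝ ℂ) A) +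
        w 0 * eval (Fin.tail w) (map (algebraMap ℝ ℂ) B) = 0 := by
    intro w hw
    obtain ⟨v, hv⟩ := hμ.exists_eval_eq hw
    have := eval_pullback m H v
    rw [h, map_zero, hv, hH] at this
    simp only [map_add, map_mul, map_X, map_rename, eval_X, eval_rename] at this
    have ha : eval w (map (algebraMap ℝ ℂ) absForm) = 0 := by
      simpa [absForm, dotProduct, sq] using hw
    rw [ha, zero_mul, zero_add] at this
    exact this.symm
  have hz : ∀ u : Fin 2 → ℂ, eval u (map (algebraMap ℝ ℂ) A) = 0 ∧
      (u 0 ^ 2 + u 1 ^ 2) * eval u (map (algebraMap ℝ ℂ) B) = 0 := by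
    intro u
    obtain ⟨s, hs⟩ := IsAlgClosed.exists_eq_mul_self (-(u 0 ^ 2 + u 1 ^ 2))
    have h1 := hcone (Fin.cons s u) (by
      simp [dotProduct, Fin.sum_univ_succ, ← hs]; ring)
    have h2 := hcone (Fin.cons (-s) u) (by
      simp [dotProduct, Fin.sum_univ_succ, ← hs]; ring)
    simp only [Fin.tail_cons, Fin.cons_zero] at h1 h2
    exact ⟨by linear_combination (h1 + h2) / 2, by
      linear_combination (-s) * (h1 - h2) / 2 - eval u (map (algebraMap ℝ ℂ) B) * hs⟩
  have hinj := map_injective (σ := Fin 2) (algebraMap ℝ ℂ) (algebraMap ℝ ℂ).injective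
  have hA : A = 0 := hinj (by
    rw [map_zero]
    exact MvPolynomial.funext fun u => by rw [(hz u).1, map_zero])
  have hB : B = 0 := hinj (by
    rw [map_zero]
    have h3 : (X 0 ^ 2 + X 1 ^ 2 : MvPolynomial (Fin 2) ℂ) * map (algebraMap ℝ ℂ) B = 0 :=
      MvPolynomial.funext fun u => by simpa using (hz u).2
    refine (mul_eq_zero.1 h3).resolve_left fun h4 => ?_
    have := congrArg (eval ![1, 0]) h4
    simp at this)
  rw [hH, hA, hB]
  simp

/-! ### Lifting automorphisms of the conic to the projective line -/

/-- The degree two Veronese vector. -/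
def veronese (v : Fin 2 → ℂ) : Fin 3 → ℂ := ![v 0 ^ 2, v 0 * v 1, v 1 ^ 2]

theorem exists_eval_eq_quadratic {p : MvPolynomial (Fin 2) ℂ} (hp : p.IsHomogeneous 2) :
    ∃ c : Fin 3 → ℂ, ∀ v, eval v p = c ⬝ᵥ veronese v := by
  let e : ℕ → (Fin 2 →₀ ℕ) := fun k => Finsupp.single 0 (2 - k) + Finsupp.single 1 k
  have he0 : ∀ k, e k 0 = 2 - k := fun k => by simp [e]
  have he1 : ∀ k, e k 1 = k := fun k => by simp [e]
  have hinj : Function.Injective e := fun a b h => by rw [← he1 a, ← he1 b, h]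
  have hsub : p.support ⊆ (Finset.range 3).image e := by
    intro d hd
    have hdeg : d 0 + d 1 = 2 := by
      have := hp (mem_support_iff.1 hd)
      simpa [Finsupp.weight_apply, Finsupp.sum_fintype] using this
    refine Finset.mem_image.2 ⟨d 1, Finset.mem_range.2 (by omega), ?_⟩
    ext i
    fin_cases i
    · change e (d 1) 0 = d 0
      rw [he0]; omega
    · exact he1 _
  refine ⟨fun k => coeff (e k) p, fun v => ?_⟩
  rw [eval_eq', Finset.sum_subset hsub (fun d _ hd => by rw [notMem_support_iff.1 hd, zero_mul]),
    Finset.sum_image hinj.injOn]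
  simp [Finset.sum_range_succ, dotProduct, Fin.sum_univ_three, veronese, he0, he1]

/-- The Gram matrix of the discriminant form on binary quadratic forms. -/
def discGram : Matrix (Fin 3) (Fin 3) ℂ := !![0, 0, -1; 0, 2, 0; -1, 0, 0]

/-- The matrix of the symmetric square of `!![x, y; z, w]`. -/
def symSq (x y z w : ℂ) : Matrix (Fin 3) (Fin 3) ℂ :=
  !![x ^ 2, 2 * (x * y), y ^ 2; x * z, x * w + y * z, y * w; z ^ 2, 2 * (z * w), w ^ 2]

theorem symSq_mulVec_veronese (x y z w : ℂ) (v : Fin 2 → ℂ) :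
    (symSq x y z w).mulVec (veronese v) = veronese ((!![x, y; z, w] : Matrix _ _ ℂ).mulVec v) := by
  ext i
  fin_cases i <;> simp [symSq, veronese, Matrix.mulVec, dotProduct, Fin.sum_univ_succ] <;> ring

theorem exists_veronese_eq {a b c : ℂ} (h : b ^ 2 = a * c) :
    ∃ x z : ℂ, a = x ^ 2 ∧ b = x * z ∧ c = z ^ 2 := by
  obtain ⟨x, hx⟩ := IsAlgClosed.exists_pow_nat_eq a (n := 2) (by norm_num)
  by_cases hx0 : x = 0
  · obtain ⟨z, hz⟩ := IsAlgClosed.exists_pow_nat_eq c (n := 2) (by norm_num)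
    subst hx0
    refine ⟨0, z, hx.symm, ?_, hz.symm⟩
    have ha : a = 0 := by rw [← hx]; norm_num
    rw [ha, zero_mul] at h
    rw [pow_eq_zero_iff (by norm_num)] at h
    rw [h, zero_mul]
  · refine ⟨x, b / x, hx.symm, by field_simp, ?_⟩
    rw [div_pow, h, ← hx]
    field_simp

/-- Similitudes of the discriminant form come from `GL₂`. The outer columns of `T` are isotropic,
hence squares of vectors `(x, z)` and `(y, w)`. The middle column is orthogonal to both, hence a
multiple of `(2xy, xw + yz, 2zw)`, and its norm determines the multiple up to sign. -/
theorem exists_symSq_eq {T : Matrix (Fin 3) (Fin 3) ℂ} {a : ℂ} (ha : a ≠ 0)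
    (hT : T.transpose * discGram * T = a • discGram) :
    ∃ x y z w : ℂ, x * w - y * z ≠ 0 ∧ T = symSq x y z w := by
  have e : ∀ i j, (T.transpose * discGram * T) i j = (a • discGram) i j := fun i j => by rw [hT]
  have e00 := e 0 0
  have e01 := e 0 1
  have e02 := e 0 2
  have e11 := e 1 1
  have e12 := e 1 2
  have e22 := e 2 2
  simp [Matrix.mul_apply, Fin.sum_univ_three, discGram] at e00 e01 e02 e11 e12 e22
  obtain ⟨x, z, h1, h2, h3⟩ := exists_veronese_eq (a := T 0 0) (b := T 1 0) (c := T 2 0)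
    (by linear_combination e00 / 2)
  obtain ⟨y, w, h4, h5, h6⟩ := exists_veronese_eq (a := T 0 2) (b := T 1 2) (c := T 2 2)
    (by linear_combination e22 / 2)
  rw [h1, h2, h3] at e01 e02
  rw [h4, h5, h6] at e02 e12
  have hD : (x * w - y * z) ^ 2 = a := by linear_combination -e02
  have hD0 : x * w - y * z ≠ 0 := fun h => ha (by rw [← hD, h]; norm_num)
  set D := x * w - y * z with hDdef
  -- `L / D ^ 2` is that multiple: `L` pairs the middle column with `(2xy, xw + yz, 2zw)`, whose own
  -- pairing is `D ^ 2`.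
  set L := -(w * z) * T 0 1 + (x * w + y * z) * T 1 1 - x * y * T 2 1 with hL
  have hD2 : D ^ 2 ≠ 0 := pow_ne_zero _ hD0
  have hu : D ^ 2 * T 0 1 = 2 * x * y * L := by
    rw [hL, hDdef]; linear_combination -x ^ 2 * e12 - y ^ 2 * e01
  have hv : D ^ 2 * T 1 1 = (x * w + y * z) * L := by
    rw [hL, hDdef]; linear_combination -x * z * e12 - y * w * e01
  have hp : D ^ 2 * T 2 1 = 2 * z * w * L := by
    rw [hL, hDdef]; linear_combination -z ^ 2 * e12 - w ^ 2 * e01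
  have hL2 : (L - D ^ 2) * (L + D ^ 2) = 0 := by
    refine (mul_eq_zero.1 (?_ : D ^ 2 * _ = 0)).resolve_left hD2
    have h7 : L ^ 2 * D ^ 2 = D ^ 4 * D ^ 2 := by
      have e11' : T 1 1 ^ 2 - T 0 1 * T 2 1 = D ^ 2 := by rw [hD]; linear_combination e11 / 2
      calc L ^ 2 * D ^ 2 = (D ^ 2 * T 1 1) ^ 2 - (D ^ 2 * T 0 1) * (D ^ 2 * T 2 1) := by
            rw [hu, hv, hp, hDdef]; ring
        _ = D ^ 4 * D ^ 2 := by linear_combination D ^ 4 * e11'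
    linear_combination h7
  have hT1 : ∀ s t r : ℂ, T 0 1 = s → T 1 1 = t → T 2 1 = r →
      T = !![x ^ 2, s, y ^ 2; x * z, t, y * w; z ^ 2, r, w ^ 2] := by
    intro s t r hs ht hr
    ext i j
    fin_cases i <;> fin_cases j <;> simp [*]
  rcases mul_eq_zero.1 hL2 with hL' | hL'
  · have hL'' : L = D ^ 2 := by linear_combination hL'
    refine ⟨x, y, z, w, hD0, hT1 _ _ _ ?_ ?_ ?_⟩ <;> refine mul_left_cancel₀ hD2 ?_
    · rw [hu, hL'']; ring
    · rw [hv, hL'']; ring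
    · rw [hp, hL'']; ring
  -- Negating `(y, w)` keeps the outer columns and reverses the middle one.
  · have hL'' : L = -D ^ 2 := by linear_combination hL'
    refine ⟨x, -y, z, -w, fun h => hD0 (by rw [hDdef]; linear_combination -h), ?_⟩
    rw [symSq, neg_sq, neg_sq, neg_mul_neg]
    refine (hT1 (2 * (x * -y)) (x * -w + -y * z) (2 * (z * -w)) ?_ ?_ ?_) <;>
      refine mul_left_cancel₀ hD2 ?_
    · rw [hu, hL'']; ring
    · rw [hv, hL'']; ring
    · rw [hp, hL'']; ring

/-- `N` is invertible because its range contains all isotropic vectors, and these span. The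
quadratic form of `N.transpose * N` vanishes on the Veronese conic, so it is a multiple of the
discriminant. -/
theorem IsConicParam.exists_matrix {μ : P1 → PInf} {m : Fin 3 → MvPolynomial (Fin 2) ℂ}
    (hμ : IsConicParam μ m) : ∃ (N : Matrix (Fin 3) (Fin 3) ℂ) (κ : ℂ), κ ≠ 0 ∧ IsUnit N ∧
      N.transpose * N = κ • discGram ∧ ∀ v, (fun i => eval v (m i)) = N.mulVec (veronese v) := by
  obtain ⟨N, hN'⟩ : ∃ N : Matrix (Fin 3) (Fin 3) ℂ, ∀ v, (fun i => eval v (m i)) =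
      N.mulVec (veronese v) := by
    choose N hN using fun i => exists_eval_eq_quadratic (hμ.isHomogeneous i)
    exact ⟨N, fun v => funext fun i => hN i v⟩
  have hunit : IsUnit N := by
    rw [← Matrix.mulVec_surjective_iff_isUnit]
    have hcone : ∀ w : Fin 3 → ℂ, w ⬝ᵥ w = 0 → ∃ v, N.mulVec v = w := fun w hw => by
      obtain ⟨v, hv⟩ := hμ.exists_eval_eq hw
      exact ⟨veronese v, by rw [← hN', hv]⟩
    obtain ⟨u1, h1⟩ := hcone ![1, Complex.I, 0] (by simp [dotProduct, Fin.sum_univ_three])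
    obtain ⟨u2, h2⟩ := hcone ![1, -Complex.I, 0] (by simp [dotProduct, Fin.sum_univ_three])
    obtain ⟨u3, h3⟩ := hcone ![0, 1, Complex.I] (by simp [dotProduct, Fin.sum_univ_three])
    intro w
    refine ⟨((w 0 + Complex.I * (-w 1 - Complex.I * w 2)) / 2) • u1 +
      ((w 0 - Complex.I * (-w 1 - Complex.I * w 2)) / 2) • u2 + (-Complex.I * w 2) • u3, ?_⟩
    rw [Matrix.mulVec_add, Matrix.mulVec_add, Matrix.mulVec_smul, Matrix.mulVec_smul,
      Matrix.mulVec_smul, h1, h2, h3]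
    have hI := Complex.I_mul_I
    ext i
    fin_cases i <;> simp
    · ring
    · linear_combination (-w 1 - Complex.I * w 2) * hI
    · linear_combination (-w 2) * hI
  set S : Matrix (Fin 3) (Fin 3) ℂ := N.transpose * N with hS
  have hSv : ∀ v : Fin 2 → ℂ, v ≠ 0 → veronese v ⬝ᵥ S.mulVec (veronese v) = 0 := by
    intro v hv
    have := hμ.dotProduct_eval hv
    rw [hN', Matrix.dotProduct_mulVec, Matrix.vecMul_mulVec,
      ← Matrix.dotProduct_mulVec] at this
    exact this
  have hsymm : ∀ i j, S i j = S j i := fun i j => by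
    simp [hS, Matrix.mul_apply, mul_comm]
  have h01 := hsymm 0 1
  have h02 := hsymm 0 2
  have h12 := hsymm 1 2
  -- Five points of a conic determine its equation up to a factor.
  have p1 := hSv ![1, 0] (fun h => by simpa using congrFun h 0)
  have p2 := hSv ![0, 1] (fun h => by simpa using congrFun h 1)
  have p3 := hSv ![1, 1] (fun h => by simpa using congrFun h 0)
  have p4 := hSv ![1, -1] (fun h => by simpa using congrFun h 0)
  have p5 := hSv ![1, 2] (fun h => by simpa using congrFun h 0)
  simp [veronese, Matrix.mulVec, dotProduct, Fin.sum_univ_three] at p1 p2 p3 p4 p5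
  have q01 : S 0 1 = 0 := by grind
  have q12 : S 1 2 = 0 := by grind
  have q02 : S 0 2 = - (S 1 1 / 2) := by grind
  have hSJ : S = (S 1 1 / 2) • discGram := by
    ext i j
    fin_cases i <;> fin_cases j <;>
      simp [discGram, p1, p2, q01, q12, q02, ← h01, ← h02, ← h12]
  refine ⟨N, S 1 1 / 2, fun h0 => ?_, hunit, hSJ, hN'⟩
  rw [h0, zero_smul] at hSJ
  have hSu : IsUnit S := ((Matrix.isUnit_transpose N).2 hunit).mul hunit
  rw [hSJ] at hSu
  exact not_isUnit_zero hSu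

/-- A matrix preserving the absolute conic lifts to a linear map of the parameter space. -/
theorem IsConicParam.exists_lift {μ : P1 → PInf} {m : Fin 3 → MvPolynomial (Fin 2) ℂ}
    (hμ : IsConicParam μ m) {A : Matrix (Fin 3) (Fin 3) ℂ} {a : ℂ} (ha : a ≠ 0)
    (hA : A.transpose * A = a • 1) : ∃ B : GL (Fin 2) ℂ, ∀ v,
      (fun i => eval ((B : Matrix (Fin 2) (Fin 2) ℂ).mulVec v) (m i)) =
        A.mulVec (fun i => eval v (m i)) := by
  obtain ⟨N, κ, hκ, hN, hNN, hm⟩ := hμ.exists_matrix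
  obtain ⟨N, rfl⟩ := hN
  set N' : Matrix (Fin 3) (Fin 3) ℂ := ((N⁻¹ : GL (Fin 3) ℂ) : Matrix (Fin 3) (Fin 3) ℂ) with hN'
  have hNN' : (N : Matrix (Fin 3) (Fin 3) ℂ) * N' = 1 := by rw [hN', ← Units.val_mul]; simp
  set T := N' * A * N with hTdef
  have hNT : (N : Matrix (Fin 3) (Fin 3) ℂ) * T = A * N := by
    rw [hTdef, ← Matrix.mul_assoc, ← Matrix.mul_assoc, hNN', Matrix.one_mul]
  -- In Veronese coordinates `A` becomes `T`, a similitude of the discriminant form with the same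
  -- factor.
  have hT : T.transpose * discGram * T = a • discGram := by
    have h1 : κ • (T.transpose * discGram * T) = κ • (a • discGram) := by
      calc κ • (T.transpose * discGram * T) = T.transpose * (κ • discGram) * T := by
            rw [Matrix.mul_smul, Matrix.smul_mul]
        _ = ((N : Matrix (Fin 3) (Fin 3) ℂ) * T).transpose *
              ((N : Matrix (Fin 3) (Fin 3) ℂ) * T) := by
            rw [← hNN, Matrix.transpose_mul (N : Matrix (Fin 3) (Fin 3) ℂ) T]; simp only [Matrix.mul_assoc]
        _ = (N : Matrix (Fin 3) (Fin 3) ℂ).transpose * (A.transpose * A) * N := by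
            rw [hNT, Matrix.transpose_mul]; simp only [Matrix.mul_assoc]
        _ = κ • (a • discGram) := by
            rw [hA, Matrix.mul_smul, Matrix.mul_one, Matrix.smul_mul, hNN, smul_comm]
    exact smul_right_injective _ hκ h1
  obtain ⟨x, y, z, w, hD, hTs⟩ := exists_symSq_eq ha hT
  refine ⟨Matrix.GeneralLinearGroup.mkOfDetNeZero !![x, y; z, w] (by simpa using hD), fun v => ?_⟩
  rw [hm, hm, Matrix.mulVec_mulVec, ← hNT, ← Matrix.mulVec_mulVec, hTs, symSq_mulVec_veronese]
  rfl

/-! ### Zeros of binary forms and projective automorphisms -/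

theorem smul_eq_mulVec {n : ℕ} (g : GL (Fin n) ℂ) (v : Fin n → ℂ) :
    g • v = (g : Matrix (Fin n) (Fin n) ℂ).mulVec v := rfl

theorem eval_comp (P : MvPolynomial (Fin 2) ℂ) (B : GL (Fin 2) ℂ) (v : Fin 2 → ℂ) :
    eval v (comp P B) = eval (B • v) P :=
  eval_linSubst _ P v

theorem mk_mem_zeros {P : MvPolynomial (Fin 2) ℂ} {n : ℕ} (hP : P.IsHomogeneous n)
    {v : Fin 2 → ℂ} (hv : v ≠ 0) : Projectivization.mk ℂ v hv ∈ zeros P ↔ eval v P = 0 := by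
  obtain ⟨a, ha⟩ := Projectivization.exists_smul_eq_mk_rep ℂ v hv
  change eval (Projectivization.mk ℂ v hv).rep P = 0 ↔ _
  rw [← ha, Units.smul_def, eval_smul_of_isHomogeneous hP]
  simp

theorem vec_one_ne_zero (z : ℂ) : (![z, 1] : Fin 2 → ℂ) ≠ 0 :=
  fun h => by simpa using congrFun h 1

theorem exists_polynomial (P : MvPolynomial (Fin 2) ℂ) :
    ∃ p : Polynomial ℂ, ∀ z, p.eval z = eval ![z, 1] P := by
  induction P using MvPolynomial.induction_on with
  | C c => exact ⟨Polynomial.C c, by simp⟩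
  | add p q hp hq =>
    obtain ⟨p', hp⟩ := hp
    obtain ⟨q', hq⟩ := hq
    exact ⟨p' + q', fun z => by rw [Polynomial.eval_add, map_add, hp, hq]⟩
  | mul_X p i hp =>
    obtain ⟨p', hp⟩ := hp
    fin_cases i
    · exact ⟨p' * Polynomial.X, fun z => by simp [hp]⟩
    · exact ⟨p', fun z => by simp [hp]⟩

theorem eq_C_mul_X_pow_of_eval {P : MvPolynomial (Fin 2) ℂ} {n : ℕ} (hP : P.IsHomogeneous n)
    {c : ℂ} (h : ∀ z, eval ![z, 1] P = c) : P = C c * X 1 ^ n := by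
  have : X 1 * (P - C c * X 1 ^ n) = 0 := by
    apply MvPolynomial.funext
    intro v
    simp only [map_mul, map_sub, map_pow, eval_X, eval_C, map_zero]
    by_cases hv : v 1 = 0
    · simp [hv]
    · have h2 : v = v 1 • ![v 0 / v 1, 1] := by
        ext i
        fin_cases i <;> simp
        field_simp
      have h3 := eval_smul_of_isHomogeneous hP (v 1) ![v 0 / v 1, 1]
      rw [← h2, h] at h3
      rw [h3]
      ring
  exact sub_eq_zero.1 ((mul_eq_zero.1 this).resolve_left (X_ne_zero 1))

theorem exists_mem_zeros {P : MvPolynomial (Fin 2) ℂ} {n : ℕ} (hP : P.IsHomogeneous n)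
    (hn : n ≠ 0) : ∃ v : Fin 2 → ℂ, v ≠ 0 ∧ eval v P = 0 := by
  obtain ⟨p, hp⟩ := exists_polynomial P
  -- A nonzero constant means that the only zero is at infinity. The zero polynomial has degree `⊥`
  -- and falls into the other case.
  by_cases hdeg : p.degree = 0
  · rw [Polynomial.eq_C_of_degree_eq_zero hdeg] at hp
    refine ⟨![1, 0], fun h => by simpa using congrFun h 0, ?_⟩
    rw [eq_C_mul_X_pow_of_eval hP (fun z => by rw [← hp, Polynomial.eval_C])]
    simp [hn]
  · obtain ⟨z, hz⟩ := IsAlgClosed.exists_root p hdeg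
    exact ⟨![z, 1], vec_one_ne_zero z, by rw [← hp]; exact hz⟩

theorem zeros_finite {P : MvPolynomial (Fin 2) ℂ} {n : ℕ} (hP : P.IsHomogeneous n)
    (hP0 : P ≠ 0) : (zeros P).Finite := by
  obtain ⟨p, hp⟩ := exists_polynomial P
  have hp0 : p ≠ 0 := by
    rintro rfl
    apply hP0
    rw [eq_C_mul_X_pow_of_eval hP (fun z => by rw [← hp, Polynomial.eval_zero])]
    simp
  have h10 : (![1, 0] : Fin 2 → ℂ) ≠ 0 := fun h => by simpa using congrFun h 0
  refine (((Polynomial.finite_setOfPred_isRoot hp0).image fun z =>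
    Projectivization.mk ℂ ![z, 1] (vec_one_ne_zero z)).insert
      (Projectivization.mk ℂ ![1, 0] h10)).subset fun q hq => ?_
  induction q using Projectivization.ind with
  | h v hv =>
    rw [mk_mem_zeros hP hv] at hq
    by_cases hv1 : v 1 = 0
    · left
      rw [Projectivization.mk_eq_mk_iff']
      refine ⟨v 0, ?_⟩
      ext i
      fin_cases i <;> simp [hv1]
    · right
      have h2 : v 1 • ![v 0 / v 1, 1] = v := by
        ext i
        fin_cases i <;> simp
        field_simp
      refine ⟨v 0 / v 1, ?_, ?_⟩
      · have h3 := eval_smul_of_isHomogeneous hP (v 1) ![v 0 / v 1, 1]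
        rw [h2, hq, eq_comm, mul_eq_zero] at h3
        change p.eval _ = 0
        rw [hp]
        exact h3.resolve_left (pow_ne_zero _ hv1)
      · rw [eq_comm, Projectivization.mk_eq_mk_iff']
        exact ⟨v 1, h2⟩

theorem image_zeros {P Q : MvPolynomial (Fin 2) ℂ} {n k : ℕ} (hP : P.IsHomogeneous n)
    (hQ : Q.IsHomogeneous k) {φ : PGL(Fin 2, ℂ)} (hφ : φ ∈ autForms P Q) :
    (fun p : P1 => φ • p) '' zeros P = zeros Q := by
  obtain ⟨B, rfl, c, hc, hcomp⟩ := hφ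
  have key : ∀ p : P1, (Matrix.ProjGenLinGroup.mk B) • p ∈ zeros Q ↔ p ∈ zeros P := by
    intro p
    induction p using Projectivization.ind with
    | h v hv =>
      rw [Projectivization.PGL.mk_smul_mk, mk_mem_zeros hQ, mk_mem_zeros hP, ← eval_comp, hcomp]
      simp [smul_eval, hc]
  ext q
  constructor
  · rintro ⟨p, hp, rfl⟩
    exact (key p).2 hp
  · intro hq
    refine ⟨(Matrix.ProjGenLinGroup.mk B)⁻¹ • q, (key _).1 ?_, ?_⟩
    · rwa [smul_inv_smul]
    · exact smul_inv_smul _ _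

theorem det_ne_zero_of_mk_ne {v w : Fin 2 → ℂ} (hv : v ≠ 0) (hw : w ≠ 0)
    (h : Projectivization.mk ℂ v hv ≠ Projectivization.mk ℂ w hw) :
    v 0 * w 1 - w 0 * v 1 ≠ 0 := by
  intro h0
  apply h
  rw [Projectivization.mk_eq_mk_iff']
  by_cases hw0 : w 0 = 0
  · have hw1 : w 1 ≠ 0 := fun h1 => hw (by ext i; fin_cases i <;> simp [hw0, h1])
    refine ⟨v 1 / w 1, ?_⟩
    rw [hw0, zero_mul, sub_zero, mul_eq_zero] at h0
    ext i
    fin_cases i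
    · simp [hw0, h0.resolve_right hw1]
    · simp [hw1]
  · refine ⟨v 0 / w 0, ?_⟩
    ext i
    fin_cases i
    · simp [hw0]
    · simp
      field_simp
      linear_combination h0

/-- An element of `PGL₂` fixing three points of the projective line is trivial. -/
theorem eq_one_of_fixes_three {φ : PGL(Fin 2, ℂ)} {p q r : P1} (hpq : p ≠ q) (hpr : p ≠ r)
    (hqr : q ≠ r) (hp : φ • p = p) (hq : φ • q = q) (hr : φ • r = r) : φ = 1 := by
  induction φ using Matrix.ProjGenLinGroup.induction_on with | mk g =>
  induction p using Projectivization.ind with | h u hu =>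
  induction q using Projectivization.ind with | h v hv =>
  induction r using Projectivization.ind with | h w hw =>
  have d1 := det_ne_zero_of_mk_ne hu hv hpq
  have d2 := det_ne_zero_of_mk_ne hu hw hpr
  have d3 := det_ne_zero_of_mk_ne hv hw hqr
  -- Fixed points are zeros of a binary quadratic form; having three distinct zeros, it vanishes
  -- identically. Its coefficients are then isolated by Cramer's rule, with the Vandermonde product
  -- `hD` as determinant.
  have key : ∀ (v : Fin 2 → ℂ) (hv : v ≠ 0), (Matrix.ProjGenLinGroup.mk g) •
      Projectivization.mk ℂ v hv = Projectivization.mk ℂ v hv →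
      g 1 0 * v 0 ^ 2 + (g 1 1 - g 0 0) * (v 0 * v 1) - g 0 1 * v 1 ^ 2 = 0 := by
    intro v hv h
    rw [Projectivization.PGL.mk_smul_mk, Projectivization.mk_eq_mk_iff'] at h
    obtain ⟨a, ha⟩ := h
    have h0 := congrFun ha 0
    have h1 := congrFun ha 1
    simp [smul_eq_mulVec, Matrix.mulVec, dotProduct, Fin.sum_univ_two] at h0 h1
    linear_combination v 1 * h0 - v 0 * h1
  have e1 := key u hu hp
  have e2 := key v hv hq
  have e3 := key w hw hr
  have hD := mul_ne_zero (mul_ne_zero d1 d2) d3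
  have h10 : g 1 0 = 0 := by
    refine (mul_eq_zero.1 (?_ : _ * g 1 0 = 0)).resolve_left hD
    linear_combination e1 * (v 1 * w 1 * (v 0 * w 1 - w 0 * v 1)) -
      e2 * (u 1 * w 1 * (u 0 * w 1 - w 0 * u 1)) + e3 * (u 1 * v 1 * (u 0 * v 1 - v 0 * u 1))
  have h01 : g 0 1 = 0 := by
    refine (mul_eq_zero.1 (?_ : _ * g 0 1 = 0)).resolve_left hD
    linear_combination -(e1 * (v 0 * w 0 * (v 0 * w 1 - w 0 * v 1)) -
      e2 * (u 0 * w 0 * (u 0 * w 1 - w 0 * u 1)) + e3 * (u 0 * v 0 * (u 0 * v 1 - v 0 * u 1)))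
  have h11 : g 1 1 - g 0 0 = 0 := by
    refine (mul_eq_zero.1 (?_ : _ * (g 1 1 - g 0 0) = 0)).resolve_left hD
    linear_combination -(e1 * (v 0 ^ 2 * w 1 ^ 2 - w 0 ^ 2 * v 1 ^ 2) -
      e2 * (u 0 ^ 2 * w 1 ^ 2 - w 0 ^ 2 * u 1 ^ 2) + e3 * (u 0 ^ 2 * v 1 ^ 2 - v 0 ^ 2 * u 1 ^ 2))
  have h00 : g 0 0 ≠ 0 := by
    intro h00
    have := g.det_ne_zero
    rw [Matrix.det_fin_two] at this
    exact this (by rw [h00, h10]; ring)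
  rw [← Matrix.ProjGenLinGroup.mk_one, eq_comm, Matrix.ProjGenLinGroup.mk_eq_mk_iff]
  refine ⟨Units.mk0 _ h00, ?_⟩
  ext i j
  fin_cases i <;> fin_cases j <;> simp [h10, h01, sub_eq_zero.1 h11]

/-- An element is determined by its action on the zeros of `P`, and there are finitely many maps
from `zeros P` to `zeros Q`. -/
theorem autForms_finite {P Q : MvPolynomial (Fin 2) ℂ} {n k : ℕ} (hP : P.IsHomogeneous n)
    (hQ : Q.IsHomogeneous k) (hP0 : P ≠ 0) (hQ0 : Q ≠ 0) (h3 : 3 ≤ (zeros P).ncard) :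
    (autForms P Q).Finite := by
  have hPf := zeros_finite hP hP0
  have : Finite (zeros P) := hPf
  have : Finite (zeros Q) := zeros_finite hQ hQ0
  obtain ⟨p, q, r, hp, hq, hr, hpq, hpr, hqr⟩ := (Set.two_lt_ncard_iff hPf).1 h3
  let Φ : autForms P Q → (zeros P → zeros Q) := fun φ x => ⟨(φ : PGL(Fin 2, ℂ)) • (x : P1), by
    rw [← image_zeros hP hQ φ.2]
    exact Set.mem_image_of_mem _ x.2⟩
  have hΦ : Function.Injective Φ := by
    intro φ φ' h
    have hx : ∀ x ∈ zeros P, ((φ' : PGL(Fin 2, ℂ))⁻¹ * φ) • x = x := fun x hx => by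
      have h1 : (φ : PGL(Fin 2, ℂ)) • x = (φ' : PGL(Fin 2, ℂ)) • x :=
        congrArg Subtype.val (congrFun h ⟨x, hx⟩)
      rw [mul_smul, h1, inv_smul_smul]
    have := eq_one_of_fixes_three hpq hpr hqr (hx p hp) (hx q hq) (hx r hr)
    exact Subtype.ext (inv_mul_eq_one.1 this).symm
  have := Finite.of_injective Φ hΦ
  exact Set.toFinite _

/-! ### The candidate set -/

theorem isHomogeneous_absForm : absForm.IsHomogeneous 2 :=
  IsHomogeneous.sum _ _ _ fun i _ => isHomogeneous_X_pow i 2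

theorem IsReducedInfinityPart.exists_isHomogeneous {d : ℕ} {F : MvPolynomial (Fin 4) ℝ}
    {Ft : MvPolynomial (Fin 3) ℝ} (hF : F.IsHomogeneous d) (hFt : IsReducedInfinityPart F Ft)
    (hdeg : 0 < Ft.totalDegree) : ∃ n, n ≠ 0 ∧ Ft.IsHomogeneous n := by
  obtain ⟨⟨k, hk⟩, hnd⟩ := hFt
  have h0 : Ft ≠ 0 := fun h => hnd (h ▸ dvd_zero _)
  have hinf : (atInfinity F).IsHomogeneous d := by
    have := hF.aeval (Fin.cons 0 X : Fin 4 → MvPolynomial (Fin 3) ℝ) (n := 1) (fun i => ?_)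
    · simpa [atInfinity] using this
    · refine Fin.cases ?_ (fun j => ?_) i
      · exact isHomogeneous_zero _ _ _
      · exact isHomogeneous_X _ _
  rw [hk] at hinf
  obtain ⟨n, hn⟩ := isHomogeneous_of_mul (isHomogeneous_absForm.pow k)
    (pow_ne_zero _ absForm_ne_zero) hinf h0
  exact ⟨n, by rw [← hn.totalDegree h0]; exact hdeg.ne', hn⟩

/-- The zeros of the pull-back of a real form come in distinct complex conjugate pairs. -/
theorem two_le_ncard_zeros {μ : P1 → PInf} {m : Fin 3 → MvPolynomial (Fin 2) ℂ}
    (hμ : IsConicParam μ m) {H : MvPolynomial (Fin 3) ℝ} {n : ℕ} (hn : n ≠ 0)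
    (hH : H.IsHomogeneous n) (hfin : (zeros (pullback m H)).Finite) :
    2 ≤ (zeros (pullback m H)).ncard := by
  have hP := isHomogeneous_pullback hμ.isHomogeneous hH
  obtain ⟨v, hv, hv0⟩ := exists_mem_zeros hP (mul_ne_zero two_ne_zero hn)
  obtain ⟨hw, -⟩ := hμ.map_mk v hv
  have hww := hμ.dotProduct_eval hv
  set w : Fin 3 → ℂ := fun i => eval v (m i) with hwdef
  rw [eval_pullback] at hv0
  obtain ⟨v', hv'⟩ := hμ.exists_eval_eq (w := star w) (by
    simpa [dotProduct] using congrArg star hww)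
  have hv'0 : v' ≠ 0 := by
    rintro rfl
    apply hw
    rw [← star_eq_zero, ← hv']
    ext i
    have := eval_smul_of_isHomogeneous (hμ.isHomogeneous i) 0 0
    simpa using this
  have hz' : eval v' (pullback m H) = 0 := by
    rw [eval_pullback, hv', eval_map]
    have h2 := congrArg (starRingEnd ℂ) hv0
    rw [eval_map, ← coe_eval₂Hom, ← RingHom.comp_apply, map_zero] at h2
    rw [← h2, comp_eval₂Hom, coe_eval₂Hom]
    congr 1
    ext x
    simp
  refine (Set.one_lt_ncard_iff hfin).2 ⟨Projectivization.mk ℂ v hv, Projectivization.mk ℂ v' hv'0,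
    (mk_mem_zeros hP hv).2 (by rw [eval_pullback]; exact hv0), (mk_mem_zeros hP hv'0).2 hz', ?_⟩
  rw [Ne, eq_comm, Projectivization.mk_eq_mk_iff']
  rintro ⟨a, rfl⟩
  -- If the two zeros coincided, the isotropic vector `w` would be proportional to its conjugate, so
  -- its Hermitian norm would vanish.
  have h3 : star w = a ^ 2 • w := by
    rw [← hv', hwdef]
    ext i
    rw [eval_smul_of_isHomogeneous (hμ.isHomogeneous i)]
    rfl
  have h4 : star w ⬝ᵥ w = 0 := by rw [h3, smul_dotProduct, hww, smul_zero]
  open scoped ComplexOrder in exact hw (dotProduct_star_self_eq_zero.1 h4)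

theorem map_transpose_mul_map {A : Matrix (Fin 3) (Fin 3) ℝ} {a : ℝ}
    (h : A.transpose * A = a • 1) :
    (A.map (algebraMap ℝ ℂ)).transpose * A.map (algebraMap ℝ ℂ) = (a : ℂ) • 1 := by
  rw [← Matrix.transpose_map, ← Matrix.map_mul, h]
  ext i j
  by_cases hij : i = j <;> simp [hij]

theorem exists_mem_autForms {d : ℕ} {F G : MvPolynomial (Fin 4) ℝ}
    (hF : IsSurfaceForm d F) (hG : IsSurfaceForm d G) {Ft Gt : MvPolynomial (Fin 3) ℝ}
    (hFt : IsReducedInfinityPart F Ft) (hGt : IsReducedInfinityPart G Gt)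
    {μ : P1 → PInf} {m : Fin 3 → MvPolynomial (Fin 2) ℂ} (hμ : IsConicParam μ m)
    {ψ : E3 ≃ᵃ[ℝ] E3} (hψ : ψ ∈ simSet (realLocus F) (realLocus G)) :
    ∃ φ ∈ autForms (pullback m Ft) (pullback m Gt), ∀ p, μ (φ • p) = actInf ψ (μ p) := by
  obtain ⟨hsim, himg⟩ := hψ
  obtain ⟨c, hc, hcF⟩ := exists_affSubst_eq hF hG ψ himg
  have hA : linMatrix ψ ∈ similitude := hsim
  obtain ⟨c', hc', hcG⟩ := exists_linSubst_eq hFt hGt hA hc (linSubst_atInfinity hcF)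
  obtain ⟨⟨a, ha, hAA⟩, -⟩ := hA
  obtain ⟨B, hB⟩ := hμ.exists_lift (Complex.ofReal_ne_zero.2 ha.ne') (map_transpose_mul_map hAA)
  refine ⟨Matrix.ProjGenLinGroup.mk B, ⟨B, rfl, c', Complex.ofReal_ne_zero.2 hc', ?_⟩, fun p => ?_⟩
  · apply MvPolynomial.funext
    intro v
    rw [eval_comp, smul_eval, eval_pullback, eval_pullback, smul_eq_mulVec, hB, ← eval_linSubst,
      ← map_linSubst, hcG, map_mul, map_C, map_mul, eval_C]
    rfl
  · induction p using Projectivization.ind with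
    | h v hv =>
      obtain ⟨h1, h2⟩ := hμ.map_mk v hv
      obtain ⟨h3, h4⟩ := hμ.map_mk (B • v) ((smul_ne_zero_iff_ne B).2 hv)
      rw [Projectivization.PGL.mk_smul_mk, h4, h2, actInf, Projectivization.smul_mk]
      congr 1
      rw [smul_eq_mulVec, hB]
      rfl

theorem eq_of_actInf_eq {F : MvPolynomial (Fin 4) ℝ} {S : Set E3}
    (hcyl : ¬ IsCylinder (realLocus F)) (hcone : ¬ IsCone (realLocus F))
    {ψ ψ' : E3 ≃ᵃ[ℝ] E3} (hψ : ψ ∈ simSet (realLocus F) S) (hψ' : ψ' ∈ simSet (realLocus F) S)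
    (h : ∀ q ∈ absConic, actInf ψ q = actInf ψ' q) : ψ = ψ' := by
  set φ := ψ'⁻¹ * ψ with hφ
  have hsim : φ ∈ Sim := Sim.mul_mem (Sim.inv_mem hψ'.1) hψ.1
  have himg : φ '' realLocus F = realLocus F := by
    have h1 : ∀ x, φ x = ψ'.symm (ψ x) := fun x => rfl
    rw [show (φ : E3 → E3) = ψ'.symm ∘ ψ from funext h1, Set.image_comp, hψ.2, ← hψ'.2,
      ← Set.image_comp]
    simp
  have hfix : ∀ q ∈ absConic, actInf φ q = q := by
    intro q hq
    have := h q hq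
    rw [actInf, actInf] at this
    rw [actInf, hφ, map_mul, map_inv, map_mul, map_inv, mul_smul, this, inv_smul_smul]
  obtain ⟨r, hr⟩ := eq_smul_one_of_fixes_absConic (linMatrix φ : Matrix (Fin 3) (Fin 3) ℝ)
    (fun v hv hvv => by
      have := hfix (Projectivization.mk ℂ v hv) hvv
      rw [actInf, Projectivization.smul_mk, Projectivization.mk_eq_mk_iff'] at this
      obtain ⟨a, ha⟩ := this
      exact ⟨a, ha.symm⟩)
  -- Here orientation matters: the determinant `r ^ 3` is positive, which excludes point
  -- reflections.
  have hr0 : 0 < r := by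
    obtain ⟨-, hdet⟩ : linMatrix φ ∈ similitude := hsim
    rw [hr, Matrix.det_smul] at hdet
    have h3 : 0 < r ^ 3 := by simpa using hdet
    exact (Odd.pow_pos_iff (by decide)).1 h3
  have := eq_one_of_image_eq_of_smul hcyl hcone φ himg hr0 (fun x => by
    rw [apply_eq_mulVec_add φ x, hr, Matrix.smul_mulVec, Matrix.one_mulVec])
  exact (inv_mul_eq_one.1 this).symm

end SurfaceSim

theorem mainTheorem4
    (d : ℕ) (F G : MvPolynomial (Fin 4) ℝ)
    (hF : SurfaceSim.IsSurfaceForm d F) (hG : SurfaceSim.IsSurfaceForm d G)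
    (R S : Set SurfaceSim.E3)
    (hR : R = SurfaceSim.realLocus F) (hS : S = SurfaceSim.realLocus G)
    (hRcyl : ¬ SurfaceSim.IsCylinder R) (hScyl : ¬ SurfaceSim.IsCylinder S)
    (hRcone : ¬ SurfaceSim.IsCone R) (hScone : ¬ SurfaceSim.IsCone S)
    (hRrev : ¬ SurfaceSim.IsRevolution R) (hSrev : ¬ SurfaceSim.IsRevolution S)
    (Ft Gt : MvPolynomial (Fin 3) ℝ)
    (hFt : SurfaceSim.IsReducedInfinityPart F Ft) (hGt : SurfaceSim.IsReducedInfinityPart G Gt)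
    (hFt0 : 0 < Ft.totalDegree) (hGt0 : 0 < Gt.totalDegree)
    (μ : SurfaceSim.P1 → SurfaceSim.PInf) (m : Fin 3 → MvPolynomial (Fin 2) ℂ)
    (hμ : SurfaceSim.IsConicParam μ m)
    (P Q : MvPolynomial (Fin 2) ℂ)
    (hP : P = SurfaceSim.pullback m Ft) (hQ : Q = SurfaceSim.pullback m Gt) :
    (∃ ι : SurfaceSim.simSet R S → SurfaceSim.autForms P Q,
      (∀ (ψ : SurfaceSim.simSet R S) (p : SurfaceSim.P1),
        μ ((ι ψ : PGL(Fin 2, ℂ)) • p) = SurfaceSim.actInf (ψ : SurfaceSim.E3 ≃ᵃ[ℝ] SurfaceSim.E3) (μ p)) ∧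
      Function.Injective ι) ∧
    ((SurfaceSim.zeros P).Finite ∧ 2 ≤ (SurfaceSim.zeros P).ncard ∧
      (SurfaceSim.zeros Q).Finite ∧ 2 ≤ (SurfaceSim.zeros Q).ncard ∧
      ∀ φ ∈ SurfaceSim.autForms P Q,
        (fun p : SurfaceSim.P1 => φ • p) '' SurfaceSim.zeros P = SurfaceSim.zeros Q) ∧
    (3 ≤ (SurfaceSim.zeros P).ncard →
      (SurfaceSim.simSet R S).Finite ∧ (SurfaceSim.autForms P Q).Finite) := by
  subst hR hS hP hQ
  obtain ⟨n, hn, hFh⟩ := hFt.exists_isHomogeneous hF.isHomogeneous hFt0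
  obtain ⟨k, hk, hGh⟩ := hGt.exists_isHomogeneous hG.isHomogeneous hGt0
  have hPh := SurfaceSim.isHomogeneous_pullback hμ.isHomogeneous hFh
  have hQh := SurfaceSim.isHomogeneous_pullback hμ.isHomogeneous hGh
  have hP0 : SurfaceSim.pullback m Ft ≠ 0 := fun h =>
    hFt.2 (SurfaceSim.absForm_dvd_of_pullback_eq_zero hμ h)
  have hQ0 : SurfaceSim.pullback m Gt ≠ 0 := fun h =>
    hGt.2 (SurfaceSim.absForm_dvd_of_pullback_eq_zero hμ h)
  have hPf := SurfaceSim.zeros_finite hPh hP0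
  have hQf := SurfaceSim.zeros_finite hQh hQ0
  choose ι hι hιμ using fun ψ : SurfaceSim.simSet (SurfaceSim.realLocus F)
    (SurfaceSim.realLocus G) => SurfaceSim.exists_mem_autForms hF hG hFt hGt hμ ψ.2
  have hinj : Function.Injective fun ψ => (⟨ι ψ, hι ψ⟩ : SurfaceSim.autForms
      (SurfaceSim.pullback m Ft) (SurfaceSim.pullback m Gt)) := by
    intro ψ ψ' h
    refine Subtype.ext (SurfaceSim.eq_of_actInf_eq hRcyl hRcone ψ.2 ψ'.2 fun q hq => ?_)
    obtain ⟨p, -, rfl⟩ := hμ.bijOn.surjOn hq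
    rw [← hιμ, ← hιμ, show ι ψ = ι ψ' from congrArg Subtype.val h]
  refine ⟨⟨_, fun ψ p => hιμ ψ p, hinj⟩, ⟨hPf, SurfaceSim.two_le_ncard_zeros hμ hn hFh hPf, hQf,
    SurfaceSim.two_le_ncard_zeros hμ hk hGh hQf, fun φ hφ => SurfaceSim.image_zeros hPh hQh hφ⟩,
    fun h3 => ?_⟩
  have hfin := SurfaceSim.autForms_finite hPh hQh hP0 hQ0 h3
  have : Finite (SurfaceSim.autForms (SurfaceSim.pullback m Ft) (SurfaceSim.pullback m Gt)) := hfin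
  have := Finite.of_injective _ hinj
  exact ⟨Set.toFinite _, hfin⟩
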